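/- All graphs are finite and simple. For a graph $G$ let $i_t(G)$ be the number of independent sets of size $t$ in $G$. A graph is $3$-chromatic if its chromatic number is exactly $3$, and $2$-connected if it has more than $2$ vertices and remains connected after the deletion of any set of fewer than $2$ vertices. $C_n$ is the cycle on $n$ vertices, $K_2\vee E_{n-2}$ is the graph obtained from a complete graph on two vertices and an edgeless graph on $n-2$ vertices by adding all edges between them, and $\theta_{a,b,c}$ ($a,b,c\ge 1$, at most one of them equal to $1$) is the theta graph consisting of two vertices $v,w$ joined by three internally disjoint paths of edge lengths $a,b,c$; it has $a+b+c-1$ vertices. Graphs are compared up to isomorphism. Let $n\ge 4$, and let $\mathcal{G}_n$ be the class of $n$-vertex $3$-chromatic $2$-connected graphs. - If $n$ is odd, then $C_n\in\mathcal{G}_n$, and every $G\in\mathcal{G}_n$ satisfies $i_2(G)\le i_2(C_n)$, with equality if and only if $G=C_n$. - If $n$ is even, then $n$-vertex theta graphs $\theta_{a,b,c}$ in which at least one of $a,b,c$ is even exist, and for each of them $\theta_{a,b,c}\in\mathcal{G}_n$ and every $G\in\mathcal{G}_n$ satisfies $i_2(G)\le i_2(\theta_{a,b,c})$, with equality if and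 only if $G=\theta_{a',b',c'}$ for some $a',b',c'$ with $a'+b'+c'-1=n$, at least one of which is even. - $K_2\vee E_{n-2}\in\mathcal{G}_n$, and for all $3\le t\le n-2$ every $G\in\mathcal{G}_n$ satisfies $i_t(G)\le i_t(K_2\vee E_{n-2})$; moreover, for $n\ge5$, equality holds if and only if $G=K_2\vee E_{n-2}$. -/

import Mathlib

namespace IndepSets

universe u v

/-- `i_t(G)`: the number of independent sets of size `t` in the finite graph `G`. -/
noncomputable def numIndep {V : Type u} [Fintype V] (G : SimpleGraph V) (t : ℕ) : ℕ :=
  (G.indepSetSet t).ncard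

/-- `G` is `l`-connected: it has more than `l` vertices, and deleting any set of fewer than `l`
vertices leaves a connected graph. -/
def IsLConnected {V : Type u} [Fintype V] (G : SimpleGraph V) (l : ℕ) : Prop :=
  l < Fintype.card V ∧
    ∀ S : Finset V, S.card < l → (G.induce {x : V | x ∉ S}).Connected

/-- `G` is an `n`-vertex `3`-chromatic `2`-connected graph. -/
structure IsThreeChromTwoConn {V : Type u} [Fintype V] (G : SimpleGraph V) (n : ℕ) : Prop where
  card_eq : Fintype.card V = n
  chromatic : G.chromaticNumber = 3
  connected : IsLConnected G 2

/-- The join `G ∨ H`: the disjoint union of `G` and `H` together with all edges between them. -/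
def graphJoin {V : Type u} {W : Type v} (G : SimpleGraph V) (H : SimpleGraph W) :
    SimpleGraph (V ⊕ W) where
  Adj x y :=
    match x, y with
    | Sum.inl a, Sum.inl b => G.Adj a b
    | Sum.inr a, Sum.inr b => H.Adj a b
    | Sum.inl _, Sum.inr _ => True
    | Sum.inr _, Sum.inl _ => True
  symm := ⟨by
    rintro (a | a) (b | b) h
    · exact G.adj_symm h
    · trivial
    · trivial
    · exact H.adj_symm h⟩
  loopless := ⟨by
    rintro (a | a) h
    · exact G.irrefl h
    · exact H.irrefl h⟩

/-- `K₂ ∨ E_m`. -/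
def K2JoinEmpty (m : ℕ) : SimpleGraph (Fin 2 ⊕ Fin m) :=
  graphJoin (⊤ : SimpleGraph (Fin 2)) (⊥ : SimpleGraph (Fin m))

/-- Vertices of a theta graph with path lengths `L 0, L 1, L 2`: two end vertices
(`false` is the start `v`, `true` is the end `w`), and `L i - 1` internal vertices on path `i`. -/
abbrev ThetaVertex (L : Fin 3 → ℕ) : Type :=
  Bool ⊕ (Σ i : Fin 3, Fin (L i - 1))

/-- The vertex at distance `k` from `v` along path `i`, for `0 ≤ k ≤ L i`. -/
def thetaPoint (L : Fin 3 → ℕ) (i : Fin 3) (k : ℕ) : ThetaVertex L :=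
  if h0 : k = 0 then Sum.inl false
  else if h : k < L i then Sum.inr ⟨i, ⟨k - 1, by omega⟩⟩
  else Sum.inl true

/-- The theta graph `θ_{a,b,c}`: the edges are those joining consecutive points of the
three paths. -/
def thetaGraph (a b c : ℕ) : SimpleGraph (ThetaVertex ![a, b, c]) :=
  SimpleGraph.fromRel fun x y =>
    ∃ i : Fin 3, ∃ k : ℕ, k < ![a, b, c] i ∧
      x = thetaPoint ![a, b, c] i k ∧ y = thetaPoint ![a, b, c] i (k + 1)

/-- `θ_{a,b,c}` is an `n`-vertex (simple) theta graph in which some path length is even: the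
lengths are positive, at most one of them is `1` (so that there are no parallel edges), and
there are `a + b + c - 1 = n` vertices. -/
structure IsEvenThetaTriple (n a b c : ℕ) : Prop where
  pos_a : 1 ≤ a
  pos_b : 1 ≤ b
  pos_c : 1 ≤ c
  simple_ab : ¬(a = 1 ∧ b = 1)
  simple_ac : ¬(a = 1 ∧ c = 1)
  simple_bc : ¬(b = 1 ∧ c = 1)
  vertices : a + b + c = n + 1
  even : Even a ∨ Even b ∨ Even c

end IndepSets

/-! Only minimum degree at least two matters for the upper bounds when `t ≥ 3`: on `n` vertices it
forces `i_t ≤ C(n-2, t)`, and equality with `t ≤ n - 2` forces an independent set missing only two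
vertices (`MinDegTwo.chooseBound`). Given `2`-connectedness and chromatic number `3`, each vertex of
that set sees both remaining vertices, which must be adjacent since otherwise the graph is
bipartite; this is `K₂ ∨ E_{n-2}`.

The bound is proved by strong induction on the number of vertices, over all graphs at once. If some
vertex can be deleted keeping minimum degree two, then `i_t(G) ≤ i_t(G-u) + i_{t-1}(G-N[u])` and
Pascal's rule suffice. If some vertex `u` of degree two has non-adjacent neighbours `a`, `b`, it is
suppressed: delete `u`, add the edge `ab`. The independent sets destroyed by the new edge are paid
for by dependent sets avoiding `u`, `a`, `b`, through the double count `card_le_card_depSubsets`. If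
neither reduction applies, there is a triangle `u b a` with `u` and `b` of degree two; deleting two
or all three of its vertices gives a strict inequality.

For `t = 2`, `i_2 = C(n,2) - e(G)`, so edges are to be minimised. Minimum degree two gives `e ≥ n`,
with equality only for a cycle; an even cycle is bipartite, so `e ≥ n + 1` for even `n`. A
`2`-connected graph with `e = n + 1` is a theta graph: delete a vertex of degree at least three and
join three of its neighbours by a tripod (`exists_tripod`). Both identifications use
`nonempty_iso_of_injective_hom`: a subgraph with the same excess of edges over vertices is already
the whole graph. -/

namespace IndepSets

/-! ### Counting independent and dependent sets inside a vertex set -/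

section Counting

open Finset
open scoped Classical

universe u
variable {V : Type u} {G : SimpleGraph V} {S W : Finset V} {s t k : ℕ}

/-- The independent `t`-subsets of the vertex set `S`. -/
noncomputable def indepSubsets (G : SimpleGraph V) (S : Finset V) (t : ℕ) : Finset (Finset V) :=
  {T ∈ S.powersetCard t | G.IsIndepSet (T : Set V)}

/-- The `t`-subsets of the vertex set `S` which span at least one edge. -/
noncomputable def depSubsets (G : SimpleGraph V) (S : Finset V) (t : ℕ) : Finset (Finset V) :=
  {T ∈ S.powersetCard t | ¬ G.IsIndepSet (T : Set V)}

/-- The neighbours of `v` in the vertex set `S`. -/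
noncomputable def nbrs (G : SimpleGraph V) (S : Finset V) (v : V) : Finset V :=
  {w ∈ S | G.Adj v w}

/-- Every vertex of `S` has at least two neighbours in `S`. -/
def MinDegTwo (G : SimpleGraph V) (S : Finset V) : Prop :=
  ∀ v ∈ S, 2 ≤ #(nbrs G S v)

theorem indep_iff {T : Finset V} :
    G.IsIndepSet (T : Set V) ↔ ∀ v ∈ T, ∀ w ∈ T, ¬ G.Adj v w := by
  rw [SimpleGraph.isIndepSet_iff]
  constructor
  · exact fun h v hv w hw hvw => h (by simpa using hv) (by simpa using hw) hvw.ne hvw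
  · intro h v hv w hw _
    exact h v (by simpa using hv) w (by simpa using hw)

theorem mem_indepSubsets {T : Finset V} :
    T ∈ indepSubsets G S t ↔ T ⊆ S ∧ #T = t ∧ ∀ v ∈ T, ∀ w ∈ T, ¬ G.Adj v w := by
  rw [indepSubsets, mem_filter, mem_powersetCard, indep_iff, and_assoc]

theorem mem_depSubsets {T : Finset V} :
    T ∈ depSubsets G S t ↔ T ⊆ S ∧ #T = t ∧ ∃ v ∈ T, ∃ w ∈ T, G.Adj v w := by
  rw [depSubsets, mem_filter, mem_powersetCard, indep_iff, and_assoc]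
  push Not
  rfl

theorem mem_nbrs {v w : V} : w ∈ nbrs G S v ↔ w ∈ S ∧ G.Adj v w := by
  simp [nbrs]

theorem card_indepSubsets_add_card_depSubsets (G : SimpleGraph V) (S : Finset V) (t : ℕ) :
    #(indepSubsets G S t) + #(depSubsets G S t) = (#S).choose t := by
  rw [indepSubsets, depSubsets, card_filter_add_card_filter_not, card_powersetCard]

theorem card_indepSubsets_le_choose (G : SimpleGraph V) (S : Finset V) (t : ℕ) :
    #(indepSubsets G S t) ≤ (#S).choose t := by
  have := card_indepSubsets_add_card_depSubsets G S t
  omega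

theorem card_indepSubsets_mono (h : S ⊆ W) (t : ℕ) :
    #(indepSubsets G S t) ≤ #(indepSubsets G W t) := by
  refine card_le_card fun T hT => ?_
  rw [mem_indepSubsets] at hT ⊢
  exact ⟨hT.1.trans h, hT.2⟩

/-- Split by membership of `v`: an independent set containing `v` is `v` together with an
independent set of non-neighbours. This is the recursion behind every reduction step. -/
theorem card_indepSubsets_succ_le (G : SimpleGraph V) (S : Finset V) (v : V) (s : ℕ) :
    #(indepSubsets G S (s + 1)) ≤ #(indepSubsets G (S.erase v) (s + 1)) +
      #(indepSubsets G {w ∈ S.erase v | ¬ G.Adj v w} s) := by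
  have hsub : indepSubsets G S (s + 1) ⊆ indepSubsets G (S.erase v) (s + 1) ∪
      (indepSubsets G {w ∈ S.erase v | ¬ G.Adj v w} s).image (insert v) := by
    intro T hT
    rw [mem_indepSubsets] at hT
    obtain ⟨hTS, hc, hi⟩ := hT
    rw [mem_union]
    by_cases hvT : v ∈ T
    · right
      refine mem_image.2 ⟨T.erase v, mem_indepSubsets.2 ⟨?_, ?_, ?_⟩, insert_erase hvT⟩
      · intro w hw
        have hw' := mem_of_mem_erase hw
        exact mem_filter.2 ⟨mem_erase.2 ⟨ne_of_mem_erase hw, hTS hw'⟩, hi v hvT w hw'⟩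
      · rw [card_erase_of_mem hvT, hc]; rfl
      · exact fun x hx y hy => hi x (mem_of_mem_erase hx) y (mem_of_mem_erase hy)
    · left
      exact mem_indepSubsets.2 ⟨fun w hw =>
        mem_erase.2 ⟨fun h => hvT (h ▸ hw), hTS hw⟩, hc, hi⟩
  calc _ ≤ _ := card_le_card hsub
    _ ≤ _ := card_union_le _ _
    _ ≤ _ := Nat.add_le_add_left card_image_le _

theorem card_nonnbrs_add {v : V} (hv : v ∈ S) :
    #{w ∈ S.erase v | ¬ G.Adj v w} + #(nbrs G S v) + 1 = #S := by
  have h : nbrs G S v = {w ∈ S.erase v | G.Adj v w} := by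
    ext w
    simp only [mem_nbrs, mem_filter, mem_erase]
    exact ⟨fun h => ⟨⟨h.2.ne', h.1⟩, h.2⟩, fun h => ⟨h.1.2, h.2⟩⟩
  rw [h, add_comm (#_) (#_), card_filter_add_card_filter_not, card_erase_of_mem hv]
  have := card_pos.2 ⟨v, hv⟩
  omega

/-- If the number of independent `t`-subsets is the number of all `t`-subsets, then
there are no edges. -/
theorem forall_not_adj_of_card_indepSubsets (h2 : 2 ≤ t) (ht : t ≤ #S)
    (h : #(indepSubsets G S t) = (#S).choose t) : ∀ v ∈ S, ∀ w ∈ S, ¬ G.Adj v w := by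
  intro v hv w hw hvw
  have hsum := card_indepSubsets_add_card_depSubsets G S t
  have hzero : depSubsets G S t = ∅ := card_eq_zero.1 (by omega)
  have hpair : ({v, w} : Finset V) ⊆ S := by
    intro x hx
    rcases mem_insert.1 hx with rfl | hx
    · exact hv
    · rwa [mem_singleton.1 hx]
  obtain ⟨T, hT1, hT2, hT3⟩ := exists_subsuperset_card_eq hpair
    ((card_le_two).trans h2) ht
  have : T ∈ depSubsets G S t :=
    mem_depSubsets.2 ⟨hT2, hT3, v, hT1 (by simp), w, hT1 (by simp), hvw⟩
  rw [hzero] at this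
  exact notMem_empty _ this

/-- A family of independent `k`-sets each of which has a vertex with two neighbours in `W`
is at most as large as the family of dependent `(k+1)`-sets. -/
theorem card_le_card_depSubsets {F : Finset (Finset V)} (hk : 1 ≤ k)
    (hF : ∀ T ∈ F, T ∈ indepSubsets G W k ∧ ∀ z ∈ T, 2 ≤ #(nbrs G W z)) :
    #F ≤ #(depSubsets G W (k + 1)) := by
  -- Double count inclusions `T ⊆ D`. A set `T` extends to a dependent set by any neighbour of one
  -- of its vertices, so in at least two ways; if `D` spans an edge `pq`, an independent `T` in it
  -- must omit `p` or `q`, so is one of two sets.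
  have key : #F * 2 ≤ #(depSubsets G W (k + 1)) * 2 := by
    refine card_mul_le_card_mul (fun T D => T ⊆ D) ?_ ?_
    · intro T hT
      obtain ⟨hTi, hT2⟩ := hF T hT
      rw [mem_indepSubsets] at hTi
      obtain ⟨hTW, hc, hi⟩ := hTi
      obtain ⟨z, hz⟩ : T.Nonempty := card_pos.1 (by omega)
      have hnot : ∀ y ∈ nbrs G W z, y ∉ T := fun y hy hyT => hi z hz y hyT (mem_nbrs.1 hy).2
      calc 2 ≤ #(nbrs G W z) := hT2 z hz
        _ = #((nbrs G W z).image fun y => insert y T) := by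
          refine (card_image_of_injOn ?_).symm
          intro y hy y' hy' hyy
          have : y ∈ insert y' T := by
            have h : insert y T = insert y' T := hyy
            rw [← h]; exact mem_insert_self _ _
          rcases mem_insert.1 this with h | h
          · exact h
          · exact absurd h (hnot y (by simpa using hy))
        _ ≤ _ := by
          refine card_le_card fun D hD => ?_
          obtain ⟨y, hy, rfl⟩ := mem_image.1 hD
          refine mem_filter.2 ⟨mem_depSubsets.2 ⟨?_, ?_, ?_⟩, subset_insert _ _⟩
          · exact insert_subset (mem_nbrs.1 hy).1 hTW
          · rw [card_insert_of_notMem (hnot y hy), hc]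
          · exact ⟨z, mem_insert_of_mem hz, y, mem_insert_self _ _, (mem_nbrs.1 hy).2⟩
    · intro D hD
      rw [mem_depSubsets] at hD
      obtain ⟨_, hc, p, hp, q, hq, hpq⟩ := hD
      refine (card_le_card (t := {D.erase p, D.erase q}) ?_).trans card_le_two
      intro T hT
      rw [mem_bipartiteBelow] at hT
      obtain ⟨hTF, hTD⟩ := hT
      obtain ⟨_, hTc, hi⟩ := mem_indepSubsets.1 (hF T hTF).1
      have aux : ∀ x ∈ D, x ∉ T → T = D.erase x := fun x hx hxT =>
        eq_of_subset_of_card_le (fun y hy => mem_erase.2 ⟨fun h => hxT (h ▸ hy), hTD hy⟩)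
          (by rw [card_erase_of_mem hx]; omega)
      rw [mem_insert, mem_singleton]
      by_cases hpT : p ∈ T
      · exact Or.inr (aux q hq fun hqT => hi p hpT q hqT hpq)
      · exact Or.inl (aux p hp hpT)
  omega

theorem card_powersetCard_filter_pair_le {v w : V} (hv : v ∈ W) (hw : w ∈ W) (hvw : v ≠ w)
    (s : ℕ) : (#W - 2).choose s ≤ #{T ∈ W.powersetCard (s + 2) | v ∈ T ∧ w ∈ T} := by
  have hc : #((W.erase v).erase w) = #W - 2 := by
    rw [card_erase_of_mem (mem_erase.2 ⟨hvw.symm, hw⟩), card_erase_of_mem hv]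
    omega
  rw [← hc, ← card_powersetCard]
  refine card_le_card_of_injOn (fun T => insert v (insert w T)) ?_ ?_
  · intro T hT
    obtain ⟨hTW, hTc⟩ := mem_powersetCard.1 (by simpa using hT)
    have hwT : w ∉ T := fun h => ne_of_mem_erase (hTW h) rfl
    have hvT : v ∉ T := fun h => ne_of_mem_erase (mem_of_mem_erase (hTW h)) rfl
    have : insert v (insert w T) ∈ {T ∈ W.powersetCard (s + 2) | v ∈ T ∧ w ∈ T} := by
      refine mem_filter.2 ⟨mem_powersetCard.2 ⟨?_, ?_⟩, by simp⟩
      · refine insert_subset hv (insert_subset hw ?_)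
        exact fun x hx => mem_of_mem_erase (mem_of_mem_erase (hTW hx))
      · rw [card_insert_of_notMem (by simp [hvw, hvT]), card_insert_of_notMem hwT, hTc]
    simpa using this
  · intro T hT T' hT' h
    have hx : ∀ T ∈ ((W.erase v).erase w).powersetCard s,
        ((insert v (insert w T)).erase v).erase w = T := by
      intro T hT
      obtain ⟨hTW, _⟩ := mem_powersetCard.1 hT
      have hwT : w ∉ T := fun h => ne_of_mem_erase (hTW h) rfl
      have hvT : v ∉ T := fun h => ne_of_mem_erase (mem_of_mem_erase (hTW h)) rfl
      rw [erase_insert (by simp [hvw, hvT]), erase_insert hwT]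
    have h' : insert v (insert w T) = insert v (insert w T') := h
    rw [← hx T (by simpa using hT), h', hx T' (by simpa using hT')]

/-- Lower bound for the number of dependent sets when there is no isolated vertex. -/
theorem card_mul_choose_le_mul_card_depSubsets (hW : ∀ v ∈ W, ∃ w ∈ W, G.Adj v w) (s : ℕ) :
    #W * (#W - 2).choose s ≤ #(depSubsets G W (s + 2)) * (s + 2) := by
  -- Double count pairs `v ∈ D`: every `(s+2)`-set containing `v` and one fixed neighbour of `v` is
  -- dependent.
  refine card_mul_le_card_mul (fun v D => v ∈ D) ?_ ?_
  · intro v hv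
    obtain ⟨w, hw, hvw⟩ := hW v hv
    refine (card_powersetCard_filter_pair_le hv hw hvw.ne s).trans (card_le_card ?_)
    intro T hT
    simp only [mem_filter, mem_powersetCard] at hT
    exact mem_filter.2 ⟨mem_depSubsets.2 ⟨hT.1.1, hT.1.2, v, hT.2.1, w, hT.2.2, hvw⟩, hT.2.1⟩
  · intro D hD
    rw [mem_depSubsets] at hD
    rw [← hD.2.1]
    exact card_le_card fun v hv => (mem_bipartiteBelow _).1 hv |>.2

theorem card_depSubsets_two_filter_mem {v : V} (hv : v ∈ W) :
    #{T ∈ depSubsets G W 2 | v ∈ T} = #(nbrs G W v) := by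
  have hinj : Set.InjOn (fun y => ({v, y} : Finset V)) (nbrs G W v) := by
    intro y hy y' hy' hyy
    have hy1 : G.Adj v y := (mem_nbrs.1 (by simpa using hy)).2
    have : y ∈ ({v, y'} : Finset V) := by
      have h : ({v, y} : Finset V) = {v, y'} := hyy
      rw [← h]; simp
    rcases mem_insert.1 this with h | h
    · exact absurd h hy1.ne'
    · exact mem_singleton.1 h
  rw [← card_image_of_injOn hinj]
  congr 1
  ext D
  rw [mem_filter, mem_depSubsets, mem_image]
  constructor
  · rintro ⟨⟨hDW, hc, p, hp, q, hq, hpq⟩, hvD⟩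
    have hD : ({p, q} : Finset V) = D := by
      refine eq_of_subset_of_card_le ?_ (by rw [card_pair hpq.ne, hc])
      intro x hx
      rcases mem_insert.1 hx with rfl | hx
      · exact hp
      · rwa [mem_singleton.1 hx]
    subst hD
    rcases mem_insert.1 hvD with rfl | h
    · exact ⟨q, mem_nbrs.2 ⟨hDW hq, hpq⟩, rfl⟩
    · rw [mem_singleton] at h
      subst h
      exact ⟨p, mem_nbrs.2 ⟨hDW hp, hpq.symm⟩, pair_comm _ _⟩
  · rintro ⟨y, hy, rfl⟩
    obtain ⟨hyW, hvy⟩ := mem_nbrs.1 hy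
    refine ⟨⟨?_, card_pair hvy.ne, v, by simp, y, by simp, hvy⟩, by simp⟩
    exact insert_subset hv (singleton_subset_iff.2 hyW)

/-- The degree sum formula. -/
theorem sum_card_nbrs (G : SimpleGraph V) (W : Finset V) :
    ∑ v ∈ W, #(nbrs G W v) = 2 * #(depSubsets G W 2) := by
  have h := sum_card_bipartiteAbove_eq_sum_card_bipartiteBelow (s := W)
    (t := depSubsets G W 2) (fun v T => v ∈ T)
  rw [← sum_congr rfl fun v hv => card_depSubsets_two_filter_mem hv]
  refine h.trans ?_
  rw [mul_comm, ← smul_eq_mul, ← sum_const]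
  refine sum_congr rfl fun T hT => ?_
  rw [mem_depSubsets] at hT
  rw [bipartiteBelow, filter_mem_eq_inter, inter_eq_right.2 hT.1, hT.2.1]

/-- A graph of minimum degree at least two has at least as many edges as vertices. -/
theorem MinDegTwo.card_le_card_depSubsets_two (hW : MinDegTwo G W) :
    #W ≤ #(depSubsets G W 2) := by
  have h := sum_card_nbrs G W
  have h2 : #W * 2 ≤ ∑ v ∈ W, #(nbrs G W v) := by
    rw [← smul_eq_mul, ← sum_const]
    exact sum_le_sum hW
  omega

end Counting

end IndepSets

namespace IndepSets

/-! ### The binomial bound: deleting or suppressing one vertex -/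

section Bound

open Finset
open scoped Classical

universe u
variable {V : Type u} {G : SimpleGraph V} {S W : Finset V} {s t k : ℕ}

/-- The bound `i_t ≤ C(n-2, t)` for the graph induced on `S`, where equality forces an
independent set missing only two vertices. -/
def ChooseBound (G : SimpleGraph V) (S : Finset V) (t : ℕ) : Prop :=
  #(indepSubsets G S t) ≤ (#S - 2).choose t ∧
    (t + 2 ≤ #S → #(indepSubsets G S t) = (#S - 2).choose t →
      ∃ I ⊆ S, #I + 2 = #S ∧ ∀ v ∈ I, ∀ w ∈ I, ¬ G.Adj v w)

theorem chooseBound_of_lt (h : #(indepSubsets G S t) < (#S - 2).choose t) : ChooseBound G S t :=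
  ⟨h.le, fun _ h' => absurd h' h.ne⟩

/-- A vertex of an independent set has at least two neighbours, all outside the set. -/
theorem MinDegTwo.indepSubsets_eq_empty (hS : MinDegTwo G S) (ht : 1 ≤ t) (h : #S < t + 2) :
    indepSubsets G S t = ∅ := by
  refine eq_empty_of_forall_notMem fun T hT => ?_
  obtain ⟨hTS, hc, hi⟩ := mem_indepSubsets.1 hT
  obtain ⟨z, hz⟩ : T.Nonempty := card_pos.1 (by omega)
  have h1 : nbrs G S z ⊆ S \ T := fun w hw =>
    mem_sdiff.2 ⟨(mem_nbrs.1 hw).1, fun hwT => hi z hz w hwT (mem_nbrs.1 hw).2⟩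
  have h2 := card_le_card h1
  rw [card_sdiff_of_subset hTS] at h2
  have := hS z (hTS hz)
  omega

/-- Removing a vertex while keeping the bound for the remaining graph. -/
theorem chooseBound_of_erase {u : V} (hu : u ∈ S) (hdeg : 2 ≤ #(nbrs G S u)) (hs : 2 ≤ s)
    (hsS : s + 3 ≤ #S)
    (ih : #(indepSubsets G (S.erase u) (s + 1)) ≤ (#(S.erase u) - 2).choose (s + 1)) :
    ChooseBound G S (s + 1) := by
  have h1 := card_indepSubsets_succ_le G S u s
  have h2 := card_nonnbrs_add (G := G) hu
  set W : Finset V := {w ∈ S.erase u | ¬ G.Adj u w} with hW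
  obtain ⟨m, hm⟩ : ∃ m, #S = m + 3 := ⟨#S - 3, by omega⟩
  have h3 := card_indepSubsets_le_choose G W s
  rw [card_erase_of_mem hu, hm] at ih
  have e1 : m + 3 - 1 - 2 = m := by omega
  have e2 : m + 3 - 2 = m + 1 := by omega
  rw [e1] at ih
  have h4 : (#W).choose s ≤ m.choose s := Nat.choose_le_choose s (by omega)
  have h5 : (m + 1).choose (s + 1) = m.choose s + m.choose (s + 1) := Nat.choose_succ_succ m s
  refine ⟨by rw [hm, e2]; omega, fun _ heq => ?_⟩
  rw [hm, e2] at heq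
  -- Equality in Pascal's rule leaves no slack: with `#W < m`, `C(#W, s)` would be strictly below
  -- `C(m, s)`. So `u` has degree two, and its non-neighbours must be independent.
  have hWm : #W = m := by
    by_contra hne
    obtain ⟨m', rfl⟩ : ∃ m', m = m' + 1 := ⟨m - 1, by omega⟩
    obtain ⟨s', rfl⟩ : ∃ s', s = s' + 1 := ⟨s - 1, by omega⟩
    have h6 : (#W).choose (s' + 1) ≤ m'.choose (s' + 1) := Nat.choose_le_choose _ (by omega)
    have h7 := Nat.choose_succ_succ m' s'
    have h8 : 0 < m'.choose s' := Nat.choose_pos (by omega)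
    simp only [Nat.succ_eq_add_one] at h7
    omega
  have hWi := forall_not_adj_of_card_indepSubsets (G := G) (S := W) hs (by omega)
    (by rw [hWm]; rw [hWm] at h3; omega)
  refine ⟨insert u W, ?_, ?_, ?_⟩
  · exact insert_subset hu fun w hw => mem_of_mem_erase (mem_filter.1 hw).1
  · rw [card_insert_of_notMem (by simp [hW]), hWm, hm]
  · intro v hv w hw
    rcases mem_insert.1 hv with rfl | hv <;> rcases mem_insert.1 hw with rfl | hw
    · exact G.loopless.irrefl _
    · exact (mem_filter.1 hw).2
    · exact fun h => (mem_filter.1 hv).2 h.symm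
    · exact hWi v hv w hw

/-! ### Suppressing a vertex of degree two -/

section Suppress

variable {u a b : V}

theorem sup_edge_adj_iff (hab : a ≠ b) {v w : V} :
    (G ⊔ SimpleGraph.edge a b).Adj v w ↔ G.Adj v w ∨ (v = a ∧ w = b ∨ v = b ∧ w = a) := by
  rw [SimpleGraph.sup_adj, SimpleGraph.edge_adj]
  constructor
  · rintro (h | ⟨h, _⟩)
    · exact Or.inl h
    · exact Or.inr h
  · rintro (h | h)
    · exact Or.inl h
    · refine Or.inr ⟨h, ?_⟩
      rcases h with ⟨rfl, rfl⟩ | ⟨rfl, rfl⟩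
      · exact hab
      · exact hab.symm

/-- No degree drops: `a` and `b` trade their neighbour `u` for each other. Non-adjacency of `a` and
`b` makes the replacement neighbour new, hence the map on neighbourhoods injective. -/
theorem MinDegTwo.suppress (hS : MinDegTwo G S) (hab : a ≠ b) (hnab : ¬ G.Adj a b)
    (hN : nbrs G S u = {a, b}) (hu : u ∈ S) :
    MinDegTwo (G ⊔ SimpleGraph.edge a b) (S.erase u) := by
  intro v hv
  obtain ⟨hvu, hvS⟩ := mem_erase.1 hv
  have ha : a ∈ S ∧ G.Adj u a := mem_nbrs.1 (by rw [hN]; simp)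
  have hb : b ∈ S ∧ G.Adj u b := mem_nbrs.1 (by rw [hN]; simp)
  have hvab : G.Adj v u → v = a ∨ v = b := fun h => by
    have : v ∈ nbrs G S u := mem_nbrs.2 ⟨hvS, h.symm⟩
    simpa [hN] using this
  refine (hS v hvS).trans (card_le_card_of_injOn
    (fun w => if w = u then (if v = a then b else a) else w) ?_ ?_)
  · intro w hw
    obtain ⟨hwS, hvw⟩ := mem_nbrs.1 (by simpa using hw)
    have : (if w = u then (if v = a then b else a) else w) ∈
        nbrs (G ⊔ SimpleGraph.edge a b) (S.erase u) v := by
      rw [mem_nbrs, sup_edge_adj_iff hab]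
      by_cases hwu : w = u
      · subst hwu
        rcases hvab hvw with rfl | rfl
        · simp [hb.1, hb.2.ne']
        · simp [hab.symm, ha.1, ha.2.ne']
      · simp [hwu, hwS, hvw]
    simpa using this
  · have hz : ∀ w ∈ nbrs G S v, ∀ w' ∈ nbrs G S v,
        (if w = u then (if v = a then b else a) else w) =
        (if w' = u then (if v = a then b else a) else w') → w = u → w' = u := by
      intro w hw w' hw' h hwu
      by_contra hne
      subst hwu
      have hvw := (mem_nbrs.1 hw).2
      have hvw' := (mem_nbrs.1 hw').2
      rw [if_pos rfl, if_neg hne] at h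
      rcases hvab hvw with rfl | rfl
      · rw [if_pos rfl] at h
        exact hnab (h ▸ hvw')
      · rw [if_neg hab.symm] at h
        exact hnab (h ▸ hvw'.symm)
    intro w hw w' hw' h
    have hw1 : w ∈ nbrs G S v := by simpa using hw
    have hw1' : w' ∈ nbrs G S v := by simpa using hw'
    by_cases hwu : w = u
    · rw [hwu, hz w hw1 w' hw1' h hwu]
    · have hwu' : w' ≠ u := fun h' => hwu (hz w' hw1' w hw1 h.symm h')
      simpa [hwu, hwu'] using h

/-- Independent sets avoiding `u` lost when the edge `ab` is added. -/
noncomputable def lostSets (G : SimpleGraph V) (S : Finset V) (u a b : V) (k : ℕ) :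
    Finset (Finset V) :=
  {T ∈ indepSubsets G {w ∈ S.erase u | ¬ G.Adj u w} k | ∀ z ∈ T, ¬ G.Adj a z ∧ ¬ G.Adj b z}

/-- Only sets containing both `a` and `b` are destroyed by the new edge; removing `a` and `b` from
such a set gives a member of `lostSets`. -/
theorem card_indepSubsets_erase_le_suppress (hab : a ≠ b) (hN : nbrs G S u = {a, b}) (k : ℕ) :
    #(indepSubsets G (S.erase u) (k + 2)) ≤
      #(indepSubsets (G ⊔ SimpleGraph.edge a b) (S.erase u) (k + 2)) +
        #(lostSets G S u a b k) := by
  have hsub : indepSubsets G (S.erase u) (k + 2) ⊆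
      indepSubsets (G ⊔ SimpleGraph.edge a b) (S.erase u) (k + 2) ∪
      (lostSets G S u a b k).image (fun T => insert a (insert b T)) := by
    intro T hT
    obtain ⟨hTS, hc, hi⟩ := mem_indepSubsets.1 hT
    rw [mem_union]
    by_cases h : a ∈ T ∧ b ∈ T
    · right
      have hba : b ∈ T.erase a := mem_erase.2 ⟨hab.symm, h.2⟩
      refine mem_image.2 ⟨(T.erase a).erase b, ?_, ?_⟩
      · have hT' : ∀ x ∈ (T.erase a).erase b, x ∈ T := fun x hx =>
          mem_of_mem_erase (mem_of_mem_erase hx)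
        refine mem_filter.2 ⟨mem_indepSubsets.2 ⟨?_, ?_, ?_⟩, ?_⟩
        · intro x hx
          refine mem_filter.2 ⟨hTS (hT' x hx), fun hux => ?_⟩
          have : x ∈ nbrs G S u := mem_nbrs.2 ⟨mem_of_mem_erase (hTS (hT' x hx)), hux⟩
          rw [hN, mem_insert, mem_singleton] at this
          rcases this with rfl | rfl
          · exact ne_of_mem_erase (mem_of_mem_erase hx) rfl
          · exact ne_of_mem_erase hx rfl
        · rw [card_erase_of_mem hba, card_erase_of_mem h.1, hc]; rfl
        · exact fun x hx y hy => hi x (hT' x hx) y (hT' y hy)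
        · exact fun z hz => ⟨hi a h.1 z (hT' z hz), hi b h.2 z (hT' z hz)⟩
      · show insert a (insert b ((T.erase a).erase b)) = T
        rw [insert_erase hba, insert_erase h.1]
    · left
      refine mem_indepSubsets.2 ⟨hTS, hc, fun v hv w hw hvw => ?_⟩
      rw [sup_edge_adj_iff hab] at hvw
      rcases hvw with hvw | ⟨rfl, rfl⟩ | ⟨rfl, rfl⟩
      · exact hi v hv w hw hvw
      · exact h ⟨hv, hw⟩
      · exact h ⟨hw, hv⟩
  calc _ ≤ _ := card_le_card hsub
    _ ≤ _ := card_union_le _ _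
    _ ≤ _ := Nat.add_le_add_left card_image_le _

/-- A vertex of a lost set is adjacent to none of `u`, `a`, `b`, so all its neighbours lie among the
remaining vertices and the double count applies there. -/
theorem card_lostSets_le (hS : MinDegTwo G S) (hN : nbrs G S u = {a, b}) (hk : 1 ≤ k) :
    #(lostSets G S u a b k) ≤ #(depSubsets G {w ∈ S.erase u | ¬ G.Adj u w} (k + 1)) := by
  refine card_le_card_depSubsets hk fun T hT => ?_
  obtain ⟨hTi, hz⟩ := mem_filter.1 hT
  refine ⟨hTi, fun z hzT => ?_⟩
  obtain ⟨hzS, huz⟩ := mem_filter.1 ((mem_indepSubsets.1 hTi).1 hzT)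
  refine (hS z (mem_of_mem_erase hzS)).trans (card_le_card fun w hw => ?_)
  obtain ⟨hwS, hzw⟩ := mem_nbrs.1 hw
  refine mem_nbrs.2 ⟨mem_filter.2 ⟨mem_erase.2 ⟨?_, hwS⟩, fun huw => ?_⟩, hzw⟩
  · rintro rfl
    exact huz hzw.symm
  · have : w ∈ nbrs G S u := mem_nbrs.2 ⟨hwS, huw⟩
    rw [hN, mem_insert, mem_singleton] at this
    rcases this with rfl | rfl
    · exact (hz z hzT).1 hzw.symm
    · exact (hz z hzT).2 hzw.symm

/-- If the suppressed graph has an independent set containing `b` whose two-vertex complement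
contains `a`, all of whose vertices see both complement vertices, then the bound is strict. -/
theorem card_lostSets_lt {I : Finset V} (hN : nbrs G S u = {a, b})
    (hk : 1 ≤ k) (hkS : k + 4 ≤ #S) (hu : u ∈ S) (hIS : I ⊆ S.erase u) (hI : #I + 3 = #S)
    (hbI : b ∈ I) (haI : a ∉ I) (ha : a ∈ S.erase u)
    (hadj : ∀ v ∈ I, ∀ x ∈ S.erase u, x ∉ I → G.Adj v x ∨ (v = b ∧ x = a)) :
    #(lostSets G S u a b k) < #(depSubsets G {w ∈ S.erase u | ¬ G.Adj u w} (k + 1)) := by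
  have hab : a ≠ b := fun h => haI (h ▸ hbI)
  have hW : ∀ w, w ∈ {w ∈ S.erase u | ¬ G.Adj u w} ↔ w ∈ S.erase u ∧ w ≠ a ∧ w ≠ b := by
    intro w
    rw [mem_filter]
    refine and_congr_right fun hw => ?_
    have : w ∈ nbrs G S u ↔ w = a ∨ w = b := by rw [hN]; simp
    rw [mem_nbrs, and_iff_right (mem_of_mem_erase hw)] at this
    rw [this, not_or]
  have hWc := card_nonnbrs_add (G := G) hu
  rw [hN, card_pair hab] at hWc
  -- Every vertex other than `u`, `a`, `b` sees `a` if it lies in `I`, and sees `b` otherwise.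
  have hempty : lostSets G S u a b k = ∅ := by
    refine eq_empty_of_forall_notMem fun T hT => ?_
    obtain ⟨hTi, hz⟩ := mem_filter.1 hT
    obtain ⟨hTW, hc, _⟩ := mem_indepSubsets.1 hTi
    obtain ⟨z, hzT⟩ : T.Nonempty := card_pos.1 (by omega)
    obtain ⟨hzS, hza, hzb⟩ := (hW z).1 (hTW hzT)
    by_cases hzI : z ∈ I
    · rcases hadj z hzI a ha haI with h | h
      · exact (hz z hzT).1 h.symm
      · exact hzb h.1
    · rcases hadj b hbI z hzS hzI with h | h
      · exact (hz z hzT).2 h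
      · exact hza h.2
  rw [hempty, card_empty, Nat.pos_iff_ne_zero]
  intro hdep
  have hsum := card_indepSubsets_add_card_depSubsets G {w ∈ S.erase u | ¬ G.Adj u w} (k + 1)
  have hWi := forall_not_adj_of_card_indepSubsets (G := G)
    (S := {w ∈ S.erase u | ¬ G.Adj u w}) (t := k + 1) (by omega) (by omega) (by omega)
  -- A vertex of `I` other than `b` and the vertex outside `I` other than `a` form an edge avoiding
  -- `u`, `a`, `b`, so some dependent set exists.
  obtain ⟨v, hv⟩ : (I.erase b).Nonempty := by
    rw [← card_pos, card_erase_of_mem hbI]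
    omega
  obtain ⟨y, hy⟩ : (((S.erase u) \ I).erase a).Nonempty := by
    rw [← card_pos, card_erase_of_mem (mem_sdiff.2 ⟨ha, haI⟩), card_sdiff_of_subset hIS,
      card_erase_of_mem hu]
    omega
  obtain ⟨hvb, hvI⟩ := mem_erase.1 hv
  obtain ⟨hya, hy'⟩ := mem_erase.1 hy
  obtain ⟨hyS, hyI⟩ := mem_sdiff.1 hy'
  rcases hadj v hvI y hyS hyI with h | h
  · exact hWi v ((hW v).2 ⟨hIS hvI, fun h => haI (h ▸ hvI), hvb⟩) y
      ((hW y).2 ⟨hyS, hya, fun h => hyI (h ▸ hbI)⟩) h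
  · exact hvb h.1

theorem lostSets_comm : lostSets G S u a b k = lostSets G S u b a k := by
  simp only [lostSets, and_comm]

/-- Suppressing a vertex of degree two with non-adjacent neighbours. -/
theorem chooseBound_of_suppress (hS : MinDegTwo G S) (hu : u ∈ S) (hab : a ≠ b)
    (hnab : ¬ G.Adj a b) (hN : nbrs G S u = {a, b}) (hk : 1 ≤ k) (hkS : k + 4 ≤ #S)
    (ih : ChooseBound (G ⊔ SimpleGraph.edge a b) (S.erase u) (k + 2)) :
    ChooseBound G S (k + 2) := by
  have h1 : #(indepSubsets G S (k + 2)) ≤ _ + _ := card_indepSubsets_succ_le G S u (k + 1)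
  rw [show k + 1 + 1 = k + 2 from rfl] at h1
  have h2 := card_indepSubsets_erase_le_suppress (G := G) hab hN k
  have h3 := card_lostSets_le hS hN hk
  have h4 := card_indepSubsets_add_card_depSubsets G {w ∈ S.erase u | ¬ G.Adj u w} (k + 1)
  have hWc := card_nonnbrs_add (G := G) hu
  rw [hN, card_pair hab] at hWc
  obtain ⟨ih1, ih2⟩ := ih
  rw [card_erase_of_mem hu] at ih1 ih2
  obtain ⟨m, hm⟩ : ∃ m, #S = m + 3 := ⟨#S - 3, by omega⟩
  have e0 : #{w ∈ S.erase u | ¬ G.Adj u w} = m := by omega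
  have e1 : m + 3 - 1 - 2 = m := by omega
  have e2 : m + 3 - 2 = m + 1 := by omega
  rw [e0] at h4
  rw [hm, e1] at ih1 ih2
  have h5 : (m + 1).choose (k + 2) = m.choose (k + 1) + m.choose (k + 2) :=
    Nat.choose_succ_succ m (k + 1)
  refine ⟨by rw [hm, e2]; omega, fun _ heq => ?_⟩
  rw [hm, e2] at heq
  -- In this boundary case the binomial is `1`, and any independent `(k+2)`-set is itself the
  -- required set; the equality clause of the induction hypothesis is not available for so few
  -- vertices.
  by_cases hlast : k + 4 = #S
  · have hpos : 0 < #(indepSubsets G S (k + 2)) := by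
      rw [heq]; exact Nat.choose_pos (by omega)
    obtain ⟨T, hT⟩ := card_pos.1 hpos
    obtain ⟨hTS, hc, hi⟩ := mem_indepSubsets.1 hT
    exact ⟨T, hTS, by omega, hi⟩
  obtain ⟨I, hIS, hI, hIi⟩ := ih2 (by omega) (by omega)
  have hS' := hS.suppress hab hnab hN hu
  have ha : a ∈ S.erase u := by
    have : a ∈ S ∧ G.Adj u a := mem_nbrs.1 (by rw [hN]; simp)
    exact mem_erase.2 ⟨this.2.ne', this.1⟩
  have hb : b ∈ S.erase u := by
    have : b ∈ S ∧ G.Adj u b := mem_nbrs.1 (by rw [hN]; simp)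
    exact mem_erase.2 ⟨this.2.ne', this.1⟩
  -- In the suppressed graph a vertex of `I` has at least two neighbours, all in the two-vertex
  -- complement of `I`, so it sees both.
  have hadj : ∀ v ∈ I, ∀ x ∈ S.erase u, x ∉ I →
      G.Adj v x ∨ (v = a ∧ x = b ∨ v = b ∧ x = a) := by
    intro v hv x hx hxI
    have hsub : nbrs (G ⊔ SimpleGraph.edge a b) (S.erase u) v ⊆ S.erase u \ I := fun w hw =>
      mem_sdiff.2 ⟨(mem_nbrs.1 hw).1, fun hwI => hIi v hv w hwI (mem_nbrs.1 hw).2⟩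
    have heq := eq_of_subset_of_card_le hsub (by
      rw [card_sdiff_of_subset hIS, card_erase_of_mem hu]
      have := hS' v (hIS hv)
      omega)
    have : x ∈ nbrs (G ⊔ SimpleGraph.edge a b) (S.erase u) v := by
      rw [heq]; exact mem_sdiff.2 ⟨hx, hxI⟩
    exact (sup_edge_adj_iff hab).1 (mem_nbrs.1 this).2
  by_cases haI : a ∈ I
  · have hbI : b ∉ I := fun hbI =>
      hIi a haI b hbI ((sup_edge_adj_iff hab).2 (Or.inr (Or.inl ⟨rfl, rfl⟩)))
    have := card_lostSets_lt (G := G) (a := b) (b := a) (by rw [hN, pair_comm]) hk hkS hu hIS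
      (by omega) haI hbI hb fun v hv x hx hxI => by
        rcases hadj v hv x hx hxI with h | h | h
        · exact Or.inl h
        · exact Or.inr h
        · exact absurd (h.1 ▸ hv) hbI
    rw [lostSets_comm] at this
    omega
  · by_cases hbI : b ∈ I
    · have := card_lostSets_lt hN hk hkS hu hIS
        (by omega) hbI haI ha fun v hv x hx hxI => by
          rcases hadj v hv x hx hxI with h | h | h
          · exact Or.inl h
          · exact absurd (h.1 ▸ hv) haI
          · exact Or.inr h
      omega
    · have huI : u ∉ I := fun h => ne_of_mem_erase (hIS h) rfl
      have huI' : ∀ w ∈ I, ¬ G.Adj u w := fun w hw huw => by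
        have : w ∈ nbrs G S u := mem_nbrs.2 ⟨mem_of_mem_erase (hIS hw), huw⟩
        rw [hN, mem_insert, mem_singleton] at this
        rcases this with rfl | rfl
        · exact haI hw
        · exact hbI hw
      refine ⟨insert u I, ?_, ?_, ?_⟩
      · exact insert_subset hu fun w hw => mem_of_mem_erase (hIS hw)
      · rw [card_insert_of_notMem huI]; omega
      · intro v hv w hw
        rcases mem_insert.1 hv with rfl | hv' <;> rcases mem_insert.1 hw with rfl | hw'
        · exact G.loopless.irrefl _
        · exact huI' w hw'
        · exact fun h => huI' v hv' h.symm
        · exact fun h => hIi v hv' w hw' ((sup_edge_adj_iff hab).2 (Or.inl h))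

end Suppress

end Bound

end IndepSets

namespace IndepSets

/-! ### The binomial bound: pendant triangles and the induction -/

section Main

open Finset
open scoped Classical

universe u
variable {V : Type u} {G : SimpleGraph V} {S : Finset V} {s t : ℕ} {u a b : V}

theorem mem_nonnbrs_of_nbrs_eq_pair (hN : nbrs G S u = {a, b}) {w : V} :
    w ∈ ({w ∈ S.erase u | ¬ G.Adj u w} : Finset V) ↔ w ∈ S ∧ w ≠ u ∧ w ≠ a ∧ w ≠ b := by
  rw [mem_filter, mem_erase]
  have h : w ∈ nbrs G S u ↔ w = a ∨ w = b := by rw [hN]; simp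
  rw [mem_nbrs] at h
  constructor
  · rintro ⟨⟨h1, h2⟩, h3⟩
    have : ¬ (w = a ∨ w = b) := fun h' => h3 (h.2 h').2
    exact ⟨h2, h1, not_or.1 this⟩
  · rintro ⟨h2, h1, h3⟩
    exact ⟨⟨h1, h2⟩, fun h' => not_or.2 h3 (h.1 ⟨h2, h'⟩)⟩

/-- Deleting two adjacent vertices of degree two lying in a triangle. -/
theorem card_indepSubsets_le_erase_erase (hu : nbrs G S u = {a, b}) (hb : nbrs G S b = {u, a})
    (s : ℕ) :
    #(indepSubsets G S (s + 1)) ≤ #(indepSubsets G ((S.erase u).erase b) (s + 1)) +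
      2 * #(indepSubsets G {w ∈ S.erase u | ¬ G.Adj u w} s) := by
  have h1 := card_indepSubsets_succ_le G S u s
  have h2 := card_indepSubsets_succ_le G (S.erase u) b s
  -- `u` and `b` have the same closed neighbourhood `{u, a, b}`, so both deletions leave the same
  -- non-neighbours.
  have h3 : #(indepSubsets G {w ∈ (S.erase u).erase b | ¬ G.Adj b w} s) ≤
      #(indepSubsets G {w ∈ S.erase u | ¬ G.Adj u w} s) := by
    refine card_indepSubsets_mono (fun w hw => ?_) s
    obtain ⟨hw1, hw2⟩ := mem_filter.1 hw
    obtain ⟨hwb, hw3⟩ := mem_erase.1 hw1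
    obtain ⟨hwu, hwS⟩ := mem_erase.1 hw3
    have : w ∈ ({w ∈ S.erase b | ¬ G.Adj b w} : Finset V) :=
      mem_filter.2 ⟨mem_erase.2 ⟨hwb, hwS⟩, hw2⟩
    rw [mem_nonnbrs_of_nbrs_eq_pair hb] at this
    exact (mem_nonnbrs_of_nbrs_eq_pair hu).2 ⟨hwS, hwu, this.2.2.2, hwb⟩
  omega

/-- Deletes the third triangle vertex `a`. With `card_indepSubsets_le_erase_erase` this gives
`i_{s+1}(S) ≤ i_{s+1}(W) + 3 i_s(W)`, where `W` is `S` without the triangle. -/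
theorem card_indepSubsets_erase_erase_le (hu : nbrs G S u = {a, b}) (s : ℕ) :
    #(indepSubsets G ((S.erase u).erase b) (s + 1)) ≤
      #(indepSubsets G {w ∈ S.erase u | ¬ G.Adj u w} (s + 1)) +
      #(indepSubsets G {w ∈ S.erase u | ¬ G.Adj u w} s) := by
  have hsub : ((S.erase u).erase b).erase a ⊆ {w ∈ S.erase u | ¬ G.Adj u w} := fun w hw => by
    simp only [mem_erase] at hw
    exact (mem_nonnbrs_of_nbrs_eq_pair hu).2 ⟨hw.2.2.2, hw.2.2.1, hw.1, hw.2.1⟩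
  exact (card_indepSubsets_succ_le G _ a s).trans (Nat.add_le_add
    (card_indepSubsets_mono hsub _)
    (card_indepSubsets_mono ((filter_subset _ _).trans hsub) _))

/-- As `a` keeps two neighbours, `u` and `b` can be deleted together. The cost is `2 i_s(W)`, with
`W` the vertices off the triangle; `W` has no isolated vertex, so it has enough dependent `s`-sets
to make the bound strict. -/
theorem chooseBound_of_triangle_of_four_le (hS : MinDegTwo G S) (hab : G.Adj a b)
    (hu : nbrs G S u = {a, b}) (hb : nbrs G S b = {u, a}) (huS : u ∈ S)
    (ha : 4 ≤ #(nbrs G S a)) (hs : 2 ≤ s) (hsS : s + 3 ≤ #S)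
    (ih : MinDegTwo G ((S.erase u).erase b) →
      #(indepSubsets G ((S.erase u).erase b) (s + 1)) ≤
        (#((S.erase u).erase b) - 2).choose (s + 1)) :
    ChooseBound G S (s + 1) := by
  have haS : a ∈ S ∧ G.Adj u a := mem_nbrs.1 (by rw [hu]; simp)
  have hbS : b ∈ S ∧ G.Adj u b := mem_nbrs.1 (by rw [hu]; simp)
  have hW := fun w => mem_nonnbrs_of_nbrs_eq_pair (w := w) hu
  have hWc := card_nonnbrs_add (G := G) huS
  rw [hu, card_pair hab.ne] at hWc
  have h1 := card_indepSubsets_le_erase_erase hu hb s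
  set W : Finset V := {w ∈ S.erase u | ¬ G.Adj u w} with hWdef
  have hnotu : ∀ z ∈ W, ∀ w ∈ S, G.Adj z w → w ≠ u ∧ w ≠ b := by
    intro z hz w hw hzw
    obtain ⟨hzS, hzu, hza, hzb⟩ := (hW z).1 hz
    constructor
    · rintro rfl
      have : z ∈ nbrs G S w := mem_nbrs.2 ⟨hzS, hzw.symm⟩
      rw [hu] at this
      simp [hza, hzb] at this
    · rintro rfl
      have : z ∈ nbrs G S w := mem_nbrs.2 ⟨hzS, hzw.symm⟩
      rw [hb] at this
      simp [hza, hzu] at this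
  have hmin : MinDegTwo G ((S.erase u).erase b) := by
    intro z hz
    obtain ⟨hzb, hz'⟩ := mem_erase.1 hz
    obtain ⟨hzu, hzS⟩ := mem_erase.1 hz'
    by_cases hza : z = a
    · have : ((nbrs G S z).erase u).erase b ⊆ nbrs G ((S.erase u).erase b) z := fun w hw => by
        simp only [mem_erase, mem_nbrs] at hw ⊢
        tauto
      have h2 := card_le_card this
      have h3 := pred_card_le_card_erase (s := (nbrs G S z).erase u) (a := b)
      have h4 := pred_card_le_card_erase (s := nbrs G S z) (a := u)
      rw [hza] at h2 h3 h4 ⊢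
      omega
    · refine (hS z hzS).trans (card_le_card fun w hw => ?_)
      obtain ⟨hwS, hzw⟩ := mem_nbrs.1 hw
      have := hnotu z ((hW z).2 ⟨hzS, hzu, hza, hzb⟩) w hwS hzw
      exact mem_nbrs.2 ⟨mem_erase.2 ⟨this.2, mem_erase.2 ⟨this.1, hwS⟩⟩, hzw⟩
  have hWnb : ∀ z ∈ W, ∃ w ∈ W, G.Adj z w := by
    intro z hz
    obtain ⟨w, hw, hwa⟩ := exists_mem_ne (hS z ((hW z).1 hz).1) a
    obtain ⟨hwS, hzw⟩ := mem_nbrs.1 hw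
    have := hnotu z hz w hwS hzw
    exact ⟨w, (hW w).2 ⟨hwS, this.1, hwa, this.2⟩, hzw⟩
  obtain ⟨r, rfl⟩ : ∃ r, s = r + 2 := ⟨s - 2, by omega⟩
  have h2 := card_mul_choose_le_mul_card_depSubsets hWnb r
  have h3 := card_indepSubsets_add_card_depSubsets G W (r + 2)
  have h4 := ih hmin
  obtain ⟨m, hm⟩ : ∃ m, #W = m + 2 := ⟨#W - 2, by omega⟩
  have hSc : #S = m + 5 := by omega
  have hc : #((S.erase u).erase b) - 2 = m + 1 := by
    rw [card_erase_of_mem (mem_erase.2 ⟨hbS.2.ne', hbS.1⟩), card_erase_of_mem huS]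
    omega
  rw [hc] at h4
  rw [hm] at h2 h3
  have e1 : m + 2 - 2 = m := by omega
  rw [e1] at h2
  have hmul : (m + 1) * m.choose r = (m + 1).choose (r + 1) * (r + 1) :=
    Nat.add_one_mul_choose_eq m r
  have hpos : 0 < m.choose r := Nat.choose_pos (by omega)
  -- This is exactly the saving needed, since `C(m+3, r+3) = C(m+1, r+3) + 2 C(m+2, r+2) - C(m+1,
  -- r+1)`.
  have hd : (m + 1).choose (r + 1) < 2 * #(depSubsets G W (r + 2)) := by
    by_contra hle
    push Not at hle
    have h5 : 2 * #(depSubsets G W (r + 2)) * (r + 2) ≤ (m + 1).choose (r + 1) * (r + 2) :=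
      Nat.mul_le_mul_right _ hle
    have h6 : (m + 1).choose (r + 1) * (r + 2) ≤ (m + 1).choose (r + 1) * (2 * (r + 1)) :=
      Nat.mul_le_mul_left _ (by omega)
    nlinarith
  have p1 : (m + 3).choose (r + 3) = (m + 2).choose (r + 2) + (m + 2).choose (r + 3) :=
    Nat.choose_succ_succ _ _
  have p2 : (m + 2).choose (r + 3) = (m + 1).choose (r + 2) + (m + 1).choose (r + 3) :=
    Nat.choose_succ_succ _ _
  have p3 : (m + 2).choose (r + 2) = (m + 1).choose (r + 1) + (m + 1).choose (r + 2) :=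
    Nat.choose_succ_succ _ _
  refine chooseBound_of_lt ?_
  have e2 : #S - 2 = m + 3 := by omega
  rw [e2]
  simp only [show r + 2 + 1 = r + 3 from rfl] at *
  omega

/-- Deleting the whole triangle gives `i_t(W) + 3 i_{t-1}(W)`, to be compared with `C(m+3, t) = C(m,
t) + 3 C(m, t-1) + 3 C(m, t-2) + C(m, t-3)`, where `#W = m + 2`; the last two terms give strictness.
-/
theorem chooseBound_of_triangle_of_minDegTwo (hab : G.Adj a b)
    (hu : nbrs G S u = {a, b}) (hb : nbrs G S b = {u, a}) (huS : u ∈ S)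
    (hs : 2 ≤ s) (hsS : s + 3 ≤ #S) (hW : MinDegTwo G {w ∈ S.erase u | ¬ G.Adj u w})
    (ih : ∀ t, 3 ≤ t → #(indepSubsets G {w ∈ S.erase u | ¬ G.Adj u w} t) ≤
        (#{w ∈ S.erase u | ¬ G.Adj u w} - 2).choose t) :
    ChooseBound G S (s + 1) := by
  have hWc := card_nonnbrs_add (G := G) huS
  rw [hu, card_pair hab.ne] at hWc
  have h1 := card_indepSubsets_le_erase_erase hu hb s
  have h2 := card_indepSubsets_erase_erase_le hu s
  set W : Finset V := {w ∈ S.erase u | ¬ G.Adj u w} with hWdef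
  obtain ⟨r, rfl⟩ : ∃ r, s = r + 2 := ⟨s - 2, by omega⟩
  have h3 := ih (r + 3) (by omega)
  obtain ⟨m, hm⟩ : ∃ m, #W = m + 2 := ⟨#W - 2, by omega⟩
  have e0 : #W - 2 = m := by omega
  have e2 : #S - 2 = m + 3 := by omega
  rw [e0] at h3
  have p1 : (m + 3).choose (r + 3) = (m + 2).choose (r + 2) + (m + 2).choose (r + 3) :=
    Nat.choose_succ_succ _ _
  have p2 : (m + 2).choose (r + 3) = (m + 1).choose (r + 2) + (m + 1).choose (r + 3) :=
    Nat.choose_succ_succ _ _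
  have p3 : (m + 2).choose (r + 2) = (m + 1).choose (r + 1) + (m + 1).choose (r + 2) :=
    Nat.choose_succ_succ _ _
  have p4 : (m + 1).choose (r + 3) = m.choose (r + 2) + m.choose (r + 3) :=
    Nat.choose_succ_succ _ _
  have p5 : (m + 1).choose (r + 2) = m.choose (r + 1) + m.choose (r + 2) :=
    Nat.choose_succ_succ _ _
  have p6 : (m + 1).choose (r + 1) = m.choose r + m.choose (r + 1) :=
    Nat.choose_succ_succ _ _
  have hpos : 0 < m.choose r := Nat.choose_pos (by omega)
  refine chooseBound_of_lt ?_
  rw [e2]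
  simp only [show r + 2 + 1 = r + 3 from rfl] at *
  -- For `t = 3` the set size `t - 1 = 2` is below the range of the induction; there `W` having at
  -- least as many edges as vertices suffices.
  rcases Nat.eq_zero_or_pos r with rfl | hr
  · have h4 := hW.card_le_card_depSubsets_two
    have h5 := card_indepSubsets_add_card_depSubsets G W 2
    rw [hm] at h4 h5
    simp only [Nat.zero_add, Nat.choose_one_right, Nat.choose_zero_right] at *
    omega
  · have h4 := ih (r + 2) (by omega)
    rw [e0] at h4
    omega

/-- The graph varies in the induction because suppression adds an edge. When neither deletion nor
suppression applies, every vertex has a neighbour of degree two and every vertex of degree two lies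
in a triangle. -/
theorem MinDegTwo.chooseBound : ∀ (N : ℕ) (G : SimpleGraph V) (S : Finset V) (t : ℕ), #S = N →
    MinDegTwo G S → 3 ≤ t → ChooseBound G S t := by
  intro N
  induction N using Nat.strong_induction_on with
  | _ N ih =>
  intro G S t hN hS ht
  by_cases hlt : #S < t + 2
  · refine ⟨?_, fun h => by omega⟩
    rw [hS.indepSubsets_eq_empty (by omega) hlt]
    simp
  obtain ⟨k, rfl⟩ : ∃ k, t = k + 2 := ⟨t - 2, by omega⟩
  have hlt' : ∀ v ∈ S, #(S.erase v) < N := fun v hv => by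
    rw [card_erase_of_mem hv]; omega
  by_cases hA : ∃ u ∈ S, MinDegTwo G (S.erase u)
  · obtain ⟨u, hu, hmin⟩ := hA
    exact chooseBound_of_erase hu (hS u hu) (s := k + 1) (by omega) (by omega)
      (ih _ (hlt' u hu) G _ (k + 2) rfl hmin ht).1
  by_cases hB : ∃ u ∈ S, ∃ a b, a ≠ b ∧ ¬ G.Adj a b ∧ nbrs G S u = {a, b}
  · obtain ⟨u, hu, a, b, hab, hnab, hNu⟩ := hB
    exact chooseBound_of_suppress hS hu hab hnab hNu (by omega) (by omega)
      (ih _ (hlt' u hu) _ _ (k + 2) rfl (hS.suppress hab hnab hNu hu) ht)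
  push Not at hA hB
  -- If deleting `u` breaks minimum degree two, the vertex that fails was a neighbour of `u` of
  -- degree exactly two.
  have key : ∀ u ∈ S, ∃ v ∈ S, G.Adj v u ∧ #(nbrs G S v) = 2 := by
    intro u hu
    have := hA u hu
    simp only [MinDegTwo] at this
    push Not at this
    obtain ⟨v, hv, hv2⟩ := this
    have hv' := mem_of_mem_erase hv
    have hsub : (nbrs G S v).erase u ⊆ nbrs G (S.erase u) v := fun w hw => by
      simp only [mem_erase, mem_nbrs] at hw ⊢
      tauto
    have h1 := card_le_card hsub
    have h2 := hS v hv'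
    have huv : u ∈ nbrs G S v := by
      by_contra hn
      rw [erase_eq_of_notMem hn] at h1
      omega
    rw [card_erase_of_mem huv] at h1
    exact ⟨v, hv', (mem_nbrs.1 huv).2, by omega⟩
  obtain ⟨x, hx⟩ : S.Nonempty := card_pos.1 (by omega)
  obtain ⟨u, hu, -, hu2⟩ := key x hx
  obtain ⟨b, hb, hbu, hb2⟩ := key u hu
  have hbN : b ∈ nbrs G S u := mem_nbrs.2 ⟨hb, hbu.symm⟩
  obtain ⟨a, ha⟩ : ∃ a, (nbrs G S u).erase b = {a} :=
    card_eq_one.1 (by rw [card_erase_of_mem hbN, hu2])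
  have hNu : nbrs G S u = {a, b} := by rw [← insert_erase hbN, ha, pair_comm]
  have hab' : a ≠ b := fun h => by
    have : a ∈ (nbrs G S u).erase b := by rw [ha]; simp
    exact ne_of_mem_erase this h
  have hab : G.Adj a b := by
    by_contra hn
    exact hB u hu a b hab' hn hNu
  have haS : a ∈ S ∧ G.Adj u a := mem_nbrs.1 (by rw [hNu]; simp)
  have hNb : nbrs G S b = {u, a} := by
    symm
    refine eq_of_subset_of_card_le ?_ (by rw [hb2, card_pair haS.2.ne])
    intro w hw
    rcases mem_insert.1 hw with rfl | hw
    · exact mem_nbrs.2 ⟨hu, hbu⟩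
    · rw [mem_singleton.1 hw]
      exact mem_nbrs.2 ⟨haS.1, hab.symm⟩
  by_cases ha4 : 4 ≤ #(nbrs G S a)
  · refine chooseBound_of_triangle_of_four_le hS hab hNu hNb hu ha4 (s := k + 1) (by omega)
      (by omega) fun hmin => ?_
    refine (ih _ ((card_le_card (erase_subset _ _)).trans_lt (hlt' u hu)) G _ (k + 2) rfl hmin ht).1
  have hmem := fun w => mem_nonnbrs_of_nbrs_eq_pair (w := w) hNu
  -- A vertex `z` losing too much has exactly two neighbours, `a` and some `e`. Since suppression is
  -- excluded, `a` and `e` are adjacent, and `u`, `b`, `z`, `e` are four neighbours of `a`, contrary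
  -- to the present case.
  have hWmin : MinDegTwo G {w ∈ S.erase u | ¬ G.Adj u w} := by
    intro z hz
    obtain ⟨hzS, hzu, hza, hzb⟩ := (hmem z).1 hz
    have huz : ¬ G.Adj z u := fun h => by
      have : z ∈ nbrs G S u := mem_nbrs.2 ⟨hzS, h.symm⟩
      simp [hNu, hza, hzb] at this
    have hbz : ¬ G.Adj z b := fun h => by
      have : z ∈ nbrs G S b := mem_nbrs.2 ⟨hzS, h.symm⟩
      simp [hNb, hza, hzu] at this
    have hsub : (nbrs G S z).erase a ⊆ nbrs G {w ∈ S.erase u | ¬ G.Adj u w} z := by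
      intro w hw
      obtain ⟨hwa, hw⟩ := mem_erase.1 hw
      obtain ⟨hwS, hzw⟩ := mem_nbrs.1 hw
      refine mem_nbrs.2 ⟨(hmem w).2 ⟨hwS, ?_, hwa, ?_⟩, hzw⟩
      · rintro rfl; exact huz hzw
      · rintro rfl; exact hbz hzw
    have h1 := card_le_card hsub
    have h2 := hS z hzS
    by_cases hzaN : a ∈ nbrs G S z
    · rw [card_erase_of_mem hzaN] at h1
      have hza' := (mem_nbrs.1 hzaN).2
      by_contra hlt2
      obtain ⟨e, he⟩ : ∃ e, (nbrs G S z).erase a = {e} :=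
        card_eq_one.1 (by rw [card_erase_of_mem hzaN]; omega)
      have heN : e ∈ (nbrs G S z).erase a := by rw [he]; simp
      obtain ⟨hea, he'⟩ := mem_erase.1 heN
      obtain ⟨heS, hze⟩ := mem_nbrs.1 he'
      have hNz : nbrs G S z = {a, e} := by rw [← insert_erase hzaN, he]
      have hae : G.Adj a e := by
        by_contra hn
        exact hB z hzS a e hea.symm hn hNz
      have h4 : ({u, b, z, e} : Finset V) ⊆ nbrs G S a := by
        intro w hw
        simp only [mem_insert, mem_singleton] at hw
        rcases hw with rfl | rfl | rfl | rfl
        · exact mem_nbrs.2 ⟨hu, haS.2.symm⟩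
        · exact mem_nbrs.2 ⟨hb, hab⟩
        · exact mem_nbrs.2 ⟨hzS, hza'.symm⟩
        · exact mem_nbrs.2 ⟨heS, hae⟩
      have heu : u ≠ e := by rintro rfl; exact huz hze
      have heb : b ≠ e := by rintro rfl; exact hbz hze
      have h5 : #({u, b, z, e} : Finset V) = 4 := by
        rw [card_insert_of_notMem (by simp [hbu.ne', hzu.symm, heu]),
          card_insert_of_notMem (by simp [hzb.symm, heb]), card_pair hze.ne]
      have := card_le_card h4
      omega
    · rw [erase_eq_of_notMem hzaN] at h1
      omega
  refine chooseBound_of_triangle_of_minDegTwo hab hNu hNb hu (s := k + 1) (by omega)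
      (by omega) hWmin fun t ht => ?_
  exact (ih _ ((card_le_card (filter_subset _ _)).trans_lt (hlt' u hu)) G _ t rfl hWmin ht).1

end Main

end IndepSets

namespace IndepSets

/-! ### Isomorphism invariance and 2-connectedness -/

section Tools

open Finset
open scoped Classical

universe u v
variable {V : Type u} [Fintype V] {W : Type v} [Fintype W] {G : SimpleGraph V}
  {H : SimpleGraph W} {n t : ℕ}

theorem numIndep_eq_card (G : SimpleGraph V) (t : ℕ) :
    numIndep G t = #(indepSubsets G univ t) := by
  rw [numIndep, ← Set.ncard_coe_finset]
  congr 1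
  ext T
  simp [SimpleGraph.mem_indepSetSet_iff, SimpleGraph.isNIndepSet_iff, indepSubsets, and_comm]

theorem numIndep_le_of_iso (e : G ≃g H) (t : ℕ) : numIndep G t ≤ numIndep H t := by
  rw [numIndep_eq_card, numIndep_eq_card]
  refine card_le_card_of_injOn (fun T => T.map e.toEquiv.toEmbedding) ?_ ?_
  · intro T hT
    obtain ⟨_, hc, hi⟩ := mem_indepSubsets.1 (by simpa using hT)
    have : T.map e.toEquiv.toEmbedding ∈ indepSubsets H univ t := by
      refine mem_indepSubsets.2 ⟨subset_univ _, by rw [card_map, hc], ?_⟩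
      intro v hv w hw
      obtain ⟨v, hv', rfl⟩ := mem_map.1 hv
      obtain ⟨w, hw', rfl⟩ := mem_map.1 hw
      exact fun h => hi v hv' w hw' (e.map_adj_iff.1 h)
    simpa using this
  · exact fun T _ T' _ h => map_injective _ h

theorem numIndep_congr (e : G ≃g H) (t : ℕ) : numIndep G t = numIndep H t :=
  (numIndep_le_of_iso e t).antisymm (numIndep_le_of_iso e.symm t)

theorem chromaticNumber_eq_three_iff {V : Type u} {G : SimpleGraph V} :
    G.chromaticNumber = 3 ↔ G.Colorable 3 ∧ ¬ G.Colorable 2 :=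
  SimpleGraph.chromaticNumber_eq_iff_colorable_not_colorable (n := 2)

/-- Connectedness after each single deletion suffices: two vertices of the whole graph are joined
after deleting some third vertex. -/
theorem isLConnected_two_of_forall_reachable (hV : 3 ≤ Fintype.card V)
    (h : ∀ x : V, ∃ r : {y // y ∈ {y : V | y ≠ x}},
      ∀ y : {y // y ∈ {y : V | y ≠ x}}, (G.induce {y : V | y ≠ x}).Reachable r y) :
    IsLConnected G 2 := by
  have hx : ∀ x, (G.induce {y : V | y ≠ x}).Connected := fun x =>
    SimpleGraph.connected_iff_exists_forall_reachable _ |>.2 (h x)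
  refine ⟨by omega, fun S hS => ?_⟩
  rcases (by omega : #S = 0 ∨ #S = 1) with h0 | h1
  · rw [card_eq_zero] at h0
    subst h0
    have hG : G.Connected := by
      have : Nonempty V := Fintype.card_pos_iff.1 (by omega)
      refine SimpleGraph.connected_iff _ |>.2 ⟨fun a b => ?_, this⟩
      obtain ⟨c, hc⟩ : ∃ c, c ∉ ({a, b} : Finset V) := by
        by_contra hcon
        push Not at hcon
        have h1 : #(univ : Finset V) ≤ #({a, b} : Finset V) := card_le_card fun c _ => hcon c
        have h2 := card_le_two (a := a) (b := b)
        rw [card_univ] at h1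
        omega
      simp only [mem_insert, mem_singleton, not_or] at hc
      have := (hx c).preconnected ⟨a, Ne.symm hc.1⟩ ⟨b, Ne.symm hc.2⟩
      exact this.map (SimpleGraph.Embedding.induce _).toHom
    have e : G.induce {x : V | x ∉ (∅ : Finset V)} ≃g G :=
      { toEquiv := Equiv.subtypeUnivEquiv (by simp)
        map_rel_iff' := Iff.rfl }
    exact e.connected_iff.2 hG
  · obtain ⟨x, rfl⟩ := card_eq_one.1 h1
    have : {y : V | y ∉ ({x} : Finset V)} = {y : V | y ≠ x} := by ext; simp
    rw [this]
    exact hx x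

theorem IsLConnected.connected_induce_ne (h : IsLConnected G 2) (x : V) :
    (G.induce {y : V | y ≠ x}).Connected := by
  have := h.2 {x} (by simp)
  have hs : {y : V | y ∉ ({x} : Finset V)} = {y : V | y ≠ x} := by ext; simp
  rwa [hs] at this

theorem IsLConnected.connected (h : IsLConnected G 2) : G.Connected := by
  have e : G.induce {x : V | x ∉ (∅ : Finset V)} ≃g G :=
    { toEquiv := Equiv.subtypeUnivEquiv (by simp)
      map_rel_iff' := Iff.rfl }
  exact e.connected_iff.1 (h.2 ∅ (by simp))

/-- A vertex has a neighbour `w`, and another one because deleting `w` leaves a connected graph with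
at least two vertices. -/
theorem IsLConnected.minDegTwo (h : IsLConnected G 2) : MinDegTwo G univ := by
  intro v _
  have hV := h.1
  have hnt : Nontrivial V := Fintype.one_lt_card_iff_nontrivial.1 (by omega)
  obtain ⟨w, hvw⟩ := h.connected.preconnected.exists_adj_of_nontrivial v
  have hnt' : Nontrivial {y // y ∈ {y : V | y ≠ w}} := by
    refine Fintype.one_lt_card_iff_nontrivial.1 ?_
    have : Fintype.card {y : V // y ≠ w} = Fintype.card V - 1 := Set.card_ne_eq w
    simp only [Set.mem_ofPred_eq]
    omega
  obtain ⟨x, hvx⟩ := (h.connected_induce_ne w).preconnected.exists_adj_of_nontrivial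
    ⟨v, hvw.ne⟩
  rw [← card_pair (a := w) (b := x.1) (fun h => x.2 h.symm)]
  refine card_le_card fun y hy => ?_
  rcases mem_insert.1 hy with rfl | hy
  · exact mem_nbrs.2 ⟨mem_univ _, hvw⟩
  · rw [mem_singleton.1 hy]
    exact mem_nbrs.2 ⟨mem_univ _, hvx⟩

end Tools

/-! ### The extremal graph for sets of size at least three -/

section Join

open Finset
open scoped Classical

universe u
variable {V : Type u} [Fintype V] {G : SimpleGraph V} {m n t : ℕ}

theorem K2JoinEmpty_adj_iff {x y : Fin 2 ⊕ Fin m} :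
    (K2JoinEmpty m).Adj x y ↔ x ≠ y ∧ (x.isLeft ∨ y.isLeft) := by
  rcases x with a | a <;> rcases y with b | b <;> simp [K2JoinEmpty, graphJoin]

theorem K2JoinEmpty_isThreeChromTwoConn (hm : 1 ≤ m) :
    IsThreeChromTwoConn (K2JoinEmpty m) (m + 2) := by
  refine ⟨by simp [add_comm], ?_, ?_⟩
  · rw [chromaticNumber_eq_three_iff]
    constructor
    · refine ⟨SimpleGraph.Coloring.mk (Sum.elim (fun i => i.castSucc) (fun _ => Fin.last 2)) ?_⟩
      intro x y h
      rw [K2JoinEmpty_adj_iff] at h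
      rcases x with a | a <;> rcases y with b | b
      · simpa using h.1
      · simpa using (Fin.castSucc_lt_last a).ne
      · simpa using (Fin.castSucc_lt_last b).ne'
      · simp at h
    · rintro ⟨c⟩
      have h1 : c (Sum.inl 0) ≠ c (Sum.inl 1) := c.valid (K2JoinEmpty_adj_iff.2 (by simp))
      have h2 : c (Sum.inl 0) ≠ c (Sum.inr ⟨0, hm⟩) := c.valid (K2JoinEmpty_adj_iff.2 (by simp))
      have h3 : c (Sum.inl 1) ≠ c (Sum.inr ⟨0, hm⟩) := c.valid (K2JoinEmpty_adj_iff.2 (by simp))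
      omega
  · refine isLConnected_two_of_forall_reachable (by simp; omega) fun x => ?_
    obtain ⟨i, hi⟩ : ∃ i : Fin 2, (Sum.inl i : Fin 2 ⊕ Fin m) ≠ x := by
      by_cases h : (Sum.inl 0 : Fin 2 ⊕ Fin m) = x
      · exact ⟨1, by rw [← h]; simp⟩
      · exact ⟨0, h⟩
    refine ⟨⟨Sum.inl i, hi⟩, fun y => ?_⟩
    by_cases h : (⟨Sum.inl i, hi⟩ : {y // y ∈ {y : Fin 2 ⊕ Fin m | y ≠ x}}) = y
    · rw [h]
    · refine SimpleGraph.Adj.reachable ?_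
      rw [SimpleGraph.comap_adj, K2JoinEmpty_adj_iff]
      exact ⟨fun h' => h (Subtype.ext h'), by simp⟩

theorem choose_le_numIndep_K2JoinEmpty (m t : ℕ) :
    m.choose t ≤ numIndep (K2JoinEmpty m) t := by
  rw [numIndep_eq_card]
  conv_lhs => rw [← Fintype.card_fin m, ← card_univ, ← card_powersetCard]
  refine card_le_card_of_injOn (fun T => T.map Function.Embedding.inr) ?_ ?_
  · intro T hT
    obtain ⟨_, hc⟩ := mem_powersetCard.1 (mem_coe.1 hT)
    have : T.map Function.Embedding.inr ∈ indepSubsets (K2JoinEmpty m) univ t := by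
      refine mem_indepSubsets.2 ⟨subset_univ _, by rw [card_map, hc], ?_⟩
      intro v hv w hw
      obtain ⟨v, hv, rfl⟩ := mem_map.1 hv
      obtain ⟨w, hw, rfl⟩ := mem_map.1 hw
      simp [K2JoinEmpty_adj_iff]
    simpa using this
  · exact fun T _ T' _ h => map_injective _ h

theorem numIndep_le_choose (hG : IsThreeChromTwoConn G n) (ht : 3 ≤ t) :
    numIndep G t ≤ (n - 2).choose t := by
  have := (MinDegTwo.chooseBound _ G univ t rfl hG.connected.minDegTwo ht).1
  rwa [card_univ, hG.card_eq, ← numIndep_eq_card] at this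

/-- The upper bound is the general theorem applied to this graph itself; the subsets of the edgeless
side attain it. -/
theorem numIndep_K2JoinEmpty (hm : 1 ≤ m) (ht : 3 ≤ t) :
    numIndep (K2JoinEmpty m) t = m.choose t :=
  (numIndep_le_choose (K2JoinEmpty_isThreeChromTwoConn hm) ht).antisymm
    (choose_le_numIndep_K2JoinEmpty m t)

/-- A `3`-chromatic `2`-connected graph with an independent set missing two vertices. -/
theorem nonempty_iso_K2JoinEmpty {I : Finset V} (hG : IsThreeChromTwoConn G n)
    (hI : #I + 2 = Fintype.card V) (hi : ∀ v ∈ I, ∀ w ∈ I, ¬ G.Adj v w) :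
    Nonempty (G ≃g K2JoinEmpty (n - 2)) := by
  have hn := hG.card_eq
  have hc : #Iᶜ = 2 := by rw [card_compl]; omega
  obtain ⟨x, y, hxy, hIxy⟩ := card_eq_two.1 hc
  have hmem : ∀ z, z ∉ I ↔ z = x ∨ z = y := fun z => by
    rw [← mem_compl, hIxy]; simp
  have hadjI : ∀ v ∈ I, ∀ z, z ∉ I → G.Adj v z := by
    intro v hv z hz
    have hsub : nbrs G univ v ⊆ Iᶜ := fun w hw =>
      mem_compl.2 fun hwI => hi v hv w hwI (mem_nbrs.1 hw).2
    have heq := eq_of_subset_of_card_le hsub (by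
      rw [hc]; exact hG.connected.minDegTwo v (mem_univ v))
    have : z ∈ nbrs G univ v := by rw [heq]; exact mem_compl.2 hz
    exact (mem_nbrs.1 this).2
  -- Otherwise `I` and `{x, y}` are the classes of a proper 2-colouring.
  have hadj : G.Adj x y := by
    by_contra hn
    have hns : ∀ z, z ∉ I → ∀ z', z' ∉ I → ¬ G.Adj z z' := by
      intro z hz z' hz' h
      rcases (hmem z).1 hz with rfl | rfl <;> rcases (hmem z').1 hz' with rfl | rfl
      · exact G.loopless.irrefl _ h
      · exact hn h
      · exact hn h.symm
      · exact G.loopless.irrefl _ h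
    refine (chromaticNumber_eq_three_iff.1 hG.chromatic).2 ⟨SimpleGraph.Coloring.mk
      (fun v => if v ∈ I then (0 : Fin 2) else 1) ?_⟩
    intro v w h
    by_cases hv : v ∈ I <;> by_cases hw : w ∈ I <;> simp only [hv, hw, if_true, if_false]
    · exact absurd h (hi v hv w hw)
    · simp
    · simp
    · exact absurd h (hns v hv w hw)
  have hiff : ∀ v w, G.Adj v w ↔ v ≠ w ∧ (v ∉ I ∨ w ∉ I) := by
    intro v w
    constructor
    · intro h
      refine ⟨h.ne, ?_⟩
      by_contra hcon
      push Not at hcon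
      exact hi v hcon.1 w hcon.2 h
    · rintro ⟨hne, h⟩
      by_cases hv : v ∈ I
      · exact hadjI v hv w (h.resolve_left (not_not.2 hv))
      · by_cases hw : w ∈ I
        · exact (hadjI w hw v hv).symm
        · rcases (hmem v).1 hv with rfl | rfl <;> rcases (hmem w).1 hw with rfl | rfl
          · exact absurd rfl hne
          · exact hadj
          · exact hadj.symm
          · exact absurd rfl hne
  have e1 : {v // v ∈ I} ≃ Fin (n - 2) :=
    Fintype.equivFinOfCardEq (by rw [Fintype.card_coe]; omega)
  have e2 : {v // ¬ v ∈ I} ≃ Fin 2 :=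
    Fintype.equivFinOfCardEq (by
      rw [Fintype.card_subtype_compl, Fintype.card_coe]; omega)
  let e : V ≃ Fin 2 ⊕ Fin (n - 2) :=
    ((Equiv.sumCompl (· ∈ I)).symm.trans (Equiv.sumComm _ _)).trans (Equiv.sumCongr e2 e1)
  have he : ∀ v, (e v).isLeft ↔ v ∉ I := by
    intro v
    by_cases hv : v ∈ I
    · simp [e, Equiv.sumCompl_symm_apply_of_pos hv, hv]
    · simp [e, Equiv.sumCompl_symm_apply_of_neg hv, hv]
  refine ⟨⟨e, ?_⟩⟩
  intro v w
  rw [K2JoinEmpty_adj_iff, hiff, he, he, e.injective.ne_iff]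

/-- The case `t ≥ 3`. -/
theorem numIndep_le_K2JoinEmpty (hG : IsThreeChromTwoConn G n) (hn : 4 ≤ n) (ht : 3 ≤ t)
    (htn : t ≤ n - 2) :
    numIndep G t ≤ numIndep (K2JoinEmpty (n - 2)) t ∧
      (numIndep G t = numIndep (K2JoinEmpty (n - 2)) t ↔
        Nonempty (G ≃g K2JoinEmpty (n - 2))) := by
  rw [numIndep_K2JoinEmpty (by omega) ht]
  refine ⟨numIndep_le_choose hG ht, fun h => ?_, fun ⟨e⟩ => ?_⟩
  · obtain ⟨I, -, hI, hi⟩ :=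
      (MinDegTwo.chooseBound _ G univ t rfl hG.connected.minDegTwo ht).2
        (by rw [card_univ, hG.card_eq]; omega)
        (by rw [card_univ, hG.card_eq, ← numIndep_eq_card, h])
    exact nonempty_iso_K2JoinEmpty hG hI hi
  · rw [numIndep_congr e, numIndep_K2JoinEmpty (by omega) ht]

end Join

end IndepSets

namespace IndepSets

/-! ### Edge counts, rigidity of subgraphs, and cycles -/

section Edges

open Finset
open scoped Classical

universe u v
variable {V : Type u} [Fintype V] {W : Type v} [Fintype W] {G : SimpleGraph V}
  {H : SimpleGraph W} {n : ℕ}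

/-- The number of edges of `G`. -/
noncomputable def edgeCount (G : SimpleGraph V) : ℕ := #(depSubsets G univ 2)

theorem numIndep_two_add_edgeCount (G : SimpleGraph V) :
    numIndep G 2 + edgeCount G = (Fintype.card V).choose 2 := by
  rw [numIndep_eq_card, edgeCount, card_indepSubsets_add_card_depSubsets, card_univ]

theorem MinDegTwo.card_le_edgeCount (h : MinDegTwo G univ) : Fintype.card V ≤ edgeCount G := by
  rw [← card_univ]
  exact h.card_le_card_depSubsets_two

/-- In a connected graph of minimum degree two, more edges meet a proper nonempty vertex set
than it has vertices. -/
theorem card_lt_card_filter_depSubsets (hG : G.Connected) (hmin : MinDegTwo G univ)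
    {U : Finset V} (hU : U.Nonempty) (hU' : ∃ w, w ∉ U) :
    #U < #{T ∈ depSubsets G univ 2 | ∃ v ∈ T, v ∈ U} := by
  obtain ⟨x, hx⟩ := hU
  obtain ⟨y, hy⟩ := hU'
  obtain ⟨p⟩ := hG.preconnected x y
  -- Each vertex of `U` has at least two incident edges and each edge has at most two ends in `U`;
  -- this edge has only one, which makes the count strict.
  obtain ⟨d, -, hd1, hd2⟩ := p.exists_boundary_dart (U : Set V) (by simpa) (by simpa)
  set E := {T ∈ depSubsets G univ 2 | ∃ v ∈ T, v ∈ U} with hE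
  have h := sum_card_bipartiteAbove_eq_sum_card_bipartiteBelow (s := U)
    (t := E) (fun (v : V) (T : Finset V) => v ∈ T)
  have h1 : #U * 2 ≤ ∑ v ∈ U, #(E.bipartiteAbove (fun (v : V) (T : Finset V) => v ∈ T) v) := by
    rw [← smul_eq_mul, ← sum_const]
    refine sum_le_sum fun v hv => (hmin v (mem_univ v)).trans ?_
    rw [← card_depSubsets_two_filter_mem (mem_univ v)]
    refine card_le_card fun T hT => ?_
    obtain ⟨hT1, hT2⟩ := mem_filter.1 hT
    exact mem_filter.2 ⟨mem_filter.2 ⟨hT1, v, hT2, hv⟩, hT2⟩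
  have h2 : ∑ T ∈ E, #(U.bipartiteBelow (fun (v : V) (T : Finset V) => v ∈ T) T) < ∑ T ∈ E, 2 := by
    have hc : ∀ T ∈ E, #T = 2 := fun T hT => (mem_depSubsets.1 (mem_filter.1 hT).1).2.1
    refine sum_lt_sum (fun T hT => ?_) ⟨({d.fst, d.snd} : Finset V), ?_, ?_⟩
    · rw [← hc T hT]
      exact card_le_card fun v hv => ((mem_bipartiteBelow _).1 hv).2
    · refine mem_filter.2 ⟨mem_depSubsets.2 ⟨subset_univ _, card_pair d.adj.ne, ?_⟩, ?_⟩
      · exact ⟨d.fst, by simp, d.snd, by simp, d.adj⟩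
      · exact ⟨d.fst, by simp, by simpa using hd1⟩
    · rw [Nat.lt_succ_iff, card_le_one]
      have key : ∀ v ∈ U.bipartiteBelow (fun (v : V) (T : Finset V) => v ∈ T) {d.fst, d.snd}, v = d.fst := by
        intro v hv
        obtain ⟨hvU, hvT⟩ := (mem_bipartiteBelow _).1 hv
        rcases mem_insert.1 hvT with h | h
        · exact h
        · rw [mem_singleton] at h
          exact absurd (h ▸ hvU) (by simpa using hd2)
      intro v hv w hw
      rw [key v hv, key w hw]
  rw [sum_const, smul_eq_mul] at h2
  omega

/-- An injectively embedded graph whose cyclomatic number is that of the ambient connected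
graph of minimum degree two is the whole graph. -/
theorem nonempty_iso_of_injective_hom (hG : G.Connected) (hmin : MinDegTwo G univ)
    [Nonempty W] (f : H →g G) (hf : Function.Injective f)
    (hcount : edgeCount G + Fintype.card W ≤ edgeCount H + Fintype.card V) :
    Nonempty (G ≃g H) := by
  have hinj : Function.Injective (fun T : Finset W => T.map ⟨f, hf⟩) := map_injective _
  set D := (depSubsets H univ 2).image (fun T : Finset W => T.map ⟨f, hf⟩) with hD
  have hDc : #D = edgeCount H := card_image_of_injective _ hinj
  have hDsub : D ⊆ depSubsets G univ 2 := by
    intro T hT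
    obtain ⟨T, hT', rfl⟩ := mem_image.1 hT
    obtain ⟨-, hc, a, ha, b, hb, hab⟩ := mem_depSubsets.1 hT'
    refine mem_depSubsets.2 ⟨subset_univ _, by rw [card_map, hc], f a, ?_, f b, ?_,
      f.map_adj hab⟩
    · exact mem_map_of_mem ⟨f, hf⟩ ha
    · exact mem_map_of_mem ⟨f, hf⟩ hb
  set R : Finset V := univ.map ⟨f, hf⟩ with hR
  have hRc : #R = Fintype.card W := by rw [hR, card_map, card_univ]
  -- Vertices missed by `f` would meet more edges than their number, none of them in the image of
  -- `H`, contradicting `hcount`.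
  have hsurj : Function.Surjective f := by
    by_contra hns
    have hU : (Rᶜ).Nonempty := by
      simp only [Function.Surjective, not_forall] at hns
      obtain ⟨y, hy⟩ := hns
      refine ⟨y, ?_⟩
      simp only [hR, mem_compl, mem_map, mem_univ, true_and, Function.Embedding.coeFn_mk]
      exact hy
    have h1 := card_lt_card_filter_depSubsets hG hmin hU
      ⟨f (Classical.arbitrary W), by simp [hR]⟩
    have hdisj : Disjoint D {T ∈ depSubsets G univ 2 | ∃ v ∈ T, v ∈ Rᶜ} := by
      rw [disjoint_left]
      intro T hT hT'
      obtain ⟨T, -, rfl⟩ := mem_image.1 hT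
      obtain ⟨-, v, hv, hvR⟩ := mem_filter.1 hT'
      obtain ⟨a, -, rfl⟩ := mem_map.1 hv
      simp [hR] at hvR
    have h2 := card_le_card (union_subset hDsub (filter_subset (fun T => ∃ v ∈ T, v ∈ Rᶜ) _))
    rw [card_union_of_disjoint hdisj, hDc] at h2
    have h3 := card_compl R
    have h4 : #R ≤ Fintype.card V := card_le_univ R
    change _ ≤ edgeCount G at h2
    omega
  have hbij : Function.Bijective f := ⟨hf, hsurj⟩
  have hcard := Fintype.card_of_bijective hbij
  have hDeq : D = depSubsets G univ 2 :=
    eq_of_subset_of_card_le hDsub (by rw [hDc]; change edgeCount G ≤ _; omega)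
  refine ⟨RelIso.symm ⟨Equiv.ofBijective f hbij, fun {a b} => ⟨fun h => ?_, fun h => f.map_adj h⟩⟩⟩
  change G.Adj (f a) (f b) at h
  have hmem : ({f a, f b} : Finset V) ∈ D := by
    rw [hDeq]
    exact mem_depSubsets.2 ⟨subset_univ _, card_pair h.ne, f a, by simp, f b, by simp, h⟩
  obtain ⟨T, hT, hTeq⟩ := mem_image.1 hmem
  have hT2 : T = {a, b} := hinj (by simp only [hTeq, map_insert, map_singleton]; rfl)
  obtain ⟨-, -, x, hx, y, hy, hxy⟩ := mem_depSubsets.1 hT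
  rw [hT2, mem_insert, mem_singleton] at hx hy
  rcases hx with rfl | rfl <;> rcases hy with rfl | rfl
  · exact absurd hxy (H.loopless.irrefl _)
  · exact hxy
  · exact hxy.symm
  · exact absurd hxy (H.loopless.irrefl _)

theorem edgeCount_congr (e : G ≃g H) : edgeCount G = edgeCount H := by
  have h1 := numIndep_two_add_edgeCount G
  have h2 := numIndep_two_add_edgeCount H
  rw [numIndep_congr e, Fintype.card_congr e.toEquiv] at h1
  omega

theorem card_nbrs_univ (G : SimpleGraph V) (v : V) [Fintype (G.neighborSet v)] :
    #(nbrs G univ v) = G.degree v := by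
  rw [← SimpleGraph.card_neighborFinset_eq_degree]
  congr 1
  ext w
  simp [mem_nbrs]

theorem edgeCount_cycleGraph (hn : 3 ≤ n) : edgeCount (SimpleGraph.cycleGraph n) = n := by
  obtain ⟨m, rfl⟩ : ∃ m, n = m + 3 := ⟨n - 3, by omega⟩
  have h := sum_card_nbrs (SimpleGraph.cycleGraph (m + 3)) univ
  have h2 : ∀ v, #(nbrs (SimpleGraph.cycleGraph (m + 3)) univ v) = 2 := fun v => by
    rw [card_nbrs_univ]
    exact SimpleGraph.cycleGraph_degree_three_le
  simp only [h2, sum_const, card_univ, Fintype.card_fin, smul_eq_mul] at h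
  change _ = 2 * edgeCount _ at h
  omega

/-- A connected graph of minimum degree two with as many edges as vertices is a cycle. -/
theorem nonempty_iso_cycleGraph (hG : G.Connected) (hmin : MinDegTwo G univ)
    (hcard : Fintype.card V = n) (hE : edgeCount G = n) :
    Nonempty (G ≃g SimpleGraph.cycleGraph n) := by
  -- A nontrivial finite tree has a leaf, contrary to minimum degree two.
  have hcyc : ¬ G.IsAcyclic := by
    intro hac
    obtain ⟨x⟩ := hG.nonempty
    have h2 := hmin x (mem_univ x)
    obtain ⟨w, hw⟩ : (nbrs G univ x).Nonempty := card_pos.1 (by omega)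
    have : Nontrivial V := ⟨x, w, (mem_nbrs.1 hw).2.ne⟩
    obtain ⟨v, hv⟩ := (SimpleGraph.IsTree.mk hG hac).exists_vert_degree_one_of_nontrivial
    have := hmin v (mem_univ v)
    rw [card_nbrs_univ, hv] at this
    omega
  simp only [SimpleGraph.IsAcyclic, not_forall, not_not] at hcyc
  obtain ⟨v, p, hp⟩ := hcyc
  have hp3 := hp.three_le_length
  obtain ⟨f⟩ := (SimpleGraph.cycleGraph_isContained_iff (by omega)).2 ⟨v, p, hp, rfl⟩
  have : Nonempty (Fin p.length) := ⟨⟨0, by omega⟩⟩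
  obtain ⟨e⟩ := nonempty_iso_of_injective_hom hG hmin f.toHom f.injective (by
    rw [edgeCount_cycleGraph hp3, Fintype.card_fin]; omega)
  have hlen := Fintype.card_congr e.toEquiv
  rw [Fintype.card_fin, hcard] at hlen
  subst hlen
  exact ⟨e⟩

/-- Consecutive points of a chain avoiding `x` are reachable without using `x`. -/
theorem reachable_of_chain {V : Type u} {G : SimpleGraph V} {x : V} (p : ℕ → V) {i j : ℕ} (hij : i ≤ j)
    (hadj : ∀ k, i ≤ k → k < j → G.Adj (p k) (p (k + 1)))
    (hne : ∀ k, i ≤ k → k ≤ j → p k ∈ {y : V | y ≠ x}) :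
    (G.induce {y : V | y ≠ x}).Reachable ⟨p i, hne i le_rfl hij⟩ ⟨p j, hne j hij le_rfl⟩ := by
  induction j, hij using Nat.le_induction with
  | base => exact SimpleGraph.Reachable.refl _
  | succ j hij ih =>
    refine (ih (fun k h1 h2 => hadj k h1 (by omega)) fun k h1 h2 => hne k h1 (by omega)).trans ?_
    refine SimpleGraph.Adj.reachable ?_
    exact hadj j hij (by omega)

/-- After deleting `x`, the walk `x + 1, x + 2, …` reaches every other vertex. -/
theorem isLConnected_cycleGraph (hn : 3 ≤ n) : IsLConnected (SimpleGraph.cycleGraph n) 2 := by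
  obtain ⟨m, rfl⟩ : ∃ m, n = m + 3 := ⟨n - 3, by omega⟩
  refine isLConnected_two_of_forall_reachable (by simp) fun x => ?_
  have hadj : ∀ k, (SimpleGraph.cycleGraph (m + 3)).Adj
      (x + Fin.ofNat (m + 3) (k + 1)) (x + Fin.ofNat (m + 3) (k + 1 + 1)) := by
    intro k
    rw [SimpleGraph.cycleGraph_adj]
    right
    rw [add_sub_add_left_eq_sub, sub_eq_iff_eq_add]
    ext
    simp [Fin.val_add, add_comm]
  have hne : ∀ k, k ≤ m + 1 → x + Fin.ofNat (m + 3) (k + 1) ∈ {y : Fin (m + 3) | y ≠ x} := by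
    intro k hk h
    rw [add_eq_left] at h
    have := congrArg Fin.val h
    simp only [Fin.ofNat, Fin.val_zero] at this
    rw [Nat.mod_eq_of_lt (by omega)] at this
    omega
  refine ⟨⟨_, hne 0 (by omega)⟩, fun ⟨y, hy⟩ => ?_⟩
  have hy0 : (y - x).val ≠ 0 := fun h => hy (sub_eq_zero.1 (Fin.ext h))
  have hlt := (y - x).isLt
  have hyk : y = x + Fin.ofNat (m + 3) ((y - x).val - 1 + 1) := by
    rw [Nat.sub_add_cancel (by omega), Fin.ofNat_eq_cast, Fin.cast_val_eq_self]
    exact (add_sub_cancel x y).symm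
  have := reachable_of_chain (G := SimpleGraph.cycleGraph (m + 3)) (x := x)
    (fun k => x + Fin.ofNat (m + 3) (k + 1)) (i := 0) (j := (y - x).val - 1) (by omega)
    (fun k _ _ => hadj k) (fun k _ hk => hne k (by omega))
  convert this using 2

/-- The odd case for independent sets of size two. -/
theorem isThreeChromTwoConn_cycleGraph (hn : 3 ≤ n) (hodd : Odd n) :
    IsThreeChromTwoConn (SimpleGraph.cycleGraph n) n :=
  ⟨Fintype.card_fin n, SimpleGraph.chromaticNumber_cycleGraph_of_odd n (by omega) hodd,
    isLConnected_cycleGraph hn⟩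

theorem numIndep_two_le_cycleGraph (hn : 3 ≤ n) (hG : IsThreeChromTwoConn G n) :
    numIndep G 2 ≤ numIndep (SimpleGraph.cycleGraph n) 2 ∧
      (numIndep G 2 = numIndep (SimpleGraph.cycleGraph n) 2 ↔
        Nonempty (G ≃g SimpleGraph.cycleGraph n)) := by
  have h1 := numIndep_two_add_edgeCount G
  have h2 := numIndep_two_add_edgeCount (SimpleGraph.cycleGraph n)
  have h3 := hG.connected.minDegTwo.card_le_edgeCount
  rw [Fintype.card_fin, edgeCount_cycleGraph hn] at h2
  rw [hG.card_eq] at h1 h3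
  refine ⟨by omega, fun h => ?_, fun ⟨e⟩ => numIndep_congr e 2⟩
  exact nonempty_iso_cycleGraph hG.connected.connected hG.connected.minDegTwo hG.card_eq (by omega)

end Edges

end IndepSets

namespace IndepSets

/-! ### Theta graphs: edges, connectivity and colourings -/

section Theta

open Finset
open scoped Classical

variable {L : Fin 3 → ℕ} {i j : Fin 3} {k l : ℕ}

/-- The theta graph with path lengths given as a family. -/
def thetaOf (L : Fin 3 → ℕ) : SimpleGraph (ThetaVertex L) :=
  SimpleGraph.fromRel fun x y =>
    ∃ i : Fin 3, ∃ k : ℕ, k < L i ∧ x = thetaPoint L i k ∧ y = thetaPoint L i (k + 1)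

theorem thetaPoint_zero : thetaPoint L i 0 = Sum.inl false := by simp [thetaPoint]

theorem thetaPoint_last (hL : 1 ≤ L i) : thetaPoint L i (L i) = Sum.inl true := by
  simp [thetaPoint]; omega

theorem thetaPoint_succ (hk : k + 1 < L i) :
    thetaPoint L i (k + 1) = Sum.inr ⟨i, ⟨k, by omega⟩⟩ := by
  simp [thetaPoint, hk]

theorem thetaPoint_eq_iff (hk : k ≤ L i) (hl : l ≤ L j) (hLi : 1 ≤ L i) (hLj : 1 ≤ L j) :
    thetaPoint L i k = thetaPoint L j l ↔
      (k = 0 ∧ l = 0) ∨ (k = L i ∧ l = L j) ∨ (i = j ∧ k = l) := by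
  have hcase : ∀ (i : Fin 3) (k : ℕ), 1 ≤ L i → k ≤ L i →
      (k = 0 ∧ thetaPoint L i k = Sum.inl false) ∨ (k = L i ∧ thetaPoint L i k = Sum.inl true) ∨
      ∃ h : k - 1 < L i - 1, 1 ≤ k ∧ k < L i ∧ thetaPoint L i k = Sum.inr ⟨i, ⟨k - 1, h⟩⟩ := by
    intro i k hLi hk
    rcases Nat.eq_zero_or_pos k with rfl | hk0
    · exact Or.inl ⟨rfl, thetaPoint_zero⟩
    rcases hk.eq_or_lt with rfl | hk1
    · exact Or.inr (Or.inl ⟨rfl, thetaPoint_last hLi⟩)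
    · obtain ⟨k, rfl⟩ : ∃ k', k = k' + 1 := ⟨k - 1, by omega⟩
      exact Or.inr (Or.inr ⟨by omega, hk0, hk1, thetaPoint_succ hk1⟩)
  rcases hcase i k hLi hk with ⟨h1, e1⟩ | ⟨h1, e1⟩ | ⟨p1, h1, h1', e1⟩ <;>
  rcases hcase j l hLj hl with ⟨h2, e2⟩ | ⟨h2, e2⟩ | ⟨p2, h2, h2', e2⟩ <;>
  rw [e1, e2]
  · simp [h1, h2]
  · simp only [Sum.inl.injEq, Bool.false_eq_true, false_iff]; rintro (h | h | ⟨rfl, h⟩) <;> omega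
  · simp only [reduceCtorEq, false_iff]; rintro (h | h | ⟨rfl, h⟩) <;> omega
  · simp only [Sum.inl.injEq, Bool.true_eq_false, false_iff]; rintro (h | h | ⟨rfl, h⟩) <;> omega
  · simp [h1, h2]
  · simp only [reduceCtorEq, false_iff]; rintro (h | h | ⟨rfl, h⟩) <;> omega
  · simp only [reduceCtorEq, false_iff]; rintro (h | h | ⟨rfl, h⟩) <;> omega
  · simp only [reduceCtorEq, false_iff]; rintro (h | h | ⟨rfl, h⟩) <;> omega
  · constructor
    · intro h
      rw [Sum.inr.injEq, Sigma.mk.injEq] at h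
      obtain ⟨rfl, h⟩ := h
      have := congrArg Fin.val (eq_of_heq h)
      simp only at this
      exact Or.inr (Or.inr ⟨rfl, by omega⟩)
    · rintro (h | h | ⟨rfl, rfl⟩)
      · omega
      · omega
      · rfl

theorem exists_eq_thetaPoint (hL : ∀ i, 1 ≤ L i) (x : ThetaVertex L) :
    ∃ i k, k ≤ L i ∧ x = thetaPoint L i k := by
  rcases x with (_ | _) | ⟨i, k⟩
  · exact ⟨0, 0, Nat.zero_le _, thetaPoint_zero.symm⟩
  · exact ⟨0, L 0, le_rfl, (thetaPoint_last (hL 0)).symm⟩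
  · have := k.isLt
    exact ⟨i, k + 1, by omega, (thetaPoint_succ (by omega)).symm⟩

theorem thetaOf_adj_iff (hL : ∀ i, 1 ≤ L i) {x y : ThetaVertex L} :
    (thetaOf L).Adj x y ↔ ∃ i k, k < L i ∧
      ((x = thetaPoint L i k ∧ y = thetaPoint L i (k + 1)) ∨
        (y = thetaPoint L i k ∧ x = thetaPoint L i (k + 1))) := by
  rw [thetaOf, SimpleGraph.fromRel_adj]
  constructor
  · rintro ⟨-, ⟨i, k, hk, h⟩ | ⟨i, k, hk, h⟩⟩
    · exact ⟨i, k, hk, Or.inl h⟩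
    · exact ⟨i, k, hk, Or.inr h⟩
  · rintro ⟨i, k, hk, h⟩
    have hne : thetaPoint L i k ≠ thetaPoint L i (k + 1) := by
      rw [Ne, thetaPoint_eq_iff hk.le hk (hL i) (hL i)]
      omega
    rcases h with h | h
    · exact ⟨by rw [h.1, h.2]; exact hne, Or.inl ⟨i, k, hk, h⟩⟩
    · exact ⟨by rw [h.1, h.2]; exact hne.symm, Or.inr ⟨i, k, hk, h⟩⟩

theorem thetaOf_adj_succ (hL : ∀ i, 1 ≤ L i) (hk : k < L i) :
    (thetaOf L).Adj (thetaPoint L i k) (thetaPoint L i (k + 1)) :=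
  (thetaOf_adj_iff hL).2 ⟨i, k, hk, Or.inl ⟨rfl, rfl⟩⟩

theorem card_thetaVertex (hL : ∀ i, 1 ≤ L i) :
    Fintype.card (ThetaVertex L) + 1 = L 0 + L 1 + L 2 := by
  have h0 := hL 0
  have h1 := hL 1
  have h2 := hL 2
  simp only [ThetaVertex, Fintype.card_sum, Fintype.card_bool, Fintype.card_sigma,
    Fintype.card_fin, Fin.sum_univ_three]
  omega

theorem edgeCount_thetaOf (hL : ∀ i, 1 ≤ L i)
    (hs : ∀ i j, L i = 1 → L j = 1 → i = j) :
    edgeCount (thetaOf L) = L 0 + L 1 + L 2 := by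
  let E : (Σ i : Fin 3, Fin (L i)) → Finset (ThetaVertex L) := fun p =>
    {thetaPoint L p.1 p.2, thetaPoint L p.1 (p.2 + 1)}
  have hE : depSubsets (thetaOf L) univ 2 = univ.image E := by
    ext T
    rw [mem_depSubsets, mem_image]
    constructor
    · rintro ⟨-, hc, x, hx, y, hy, hxy⟩
      have hT : ({x, y} : Finset (ThetaVertex L)) = T := by
        refine eq_of_subset_of_card_le ?_ (by rw [card_pair hxy.ne, hc])
        exact insert_subset hx (singleton_subset_iff.2 hy)
      obtain ⟨i, k, hk, h⟩ := (thetaOf_adj_iff hL).1 hxy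
      refine ⟨⟨i, ⟨k, hk⟩⟩, mem_univ _, ?_⟩
      rw [← hT]
      rcases h with ⟨rfl, rfl⟩ | ⟨rfl, rfl⟩
      · rfl
      · exact pair_comm _ _
    · rintro ⟨⟨i, k⟩, -, rfl⟩
      have h := thetaOf_adj_succ hL k.isLt
      exact ⟨subset_univ _, card_pair h.ne, _, mem_insert_self _ _, _,
        mem_insert_of_mem (mem_singleton_self _), h⟩
  have hinj : Function.Injective E := by
    rintro ⟨i, k, hk⟩ ⟨j, l, hl⟩ h
    have hi := hL i
    have hj := hL j
    simp only [E] at h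
    have h1 : thetaPoint L i k ∈ ({thetaPoint L j l, thetaPoint L j (l + 1)} : Finset _) := by
      rw [← h]; simp
    have h2 : thetaPoint L i (k + 1) ∈
        ({thetaPoint L j l, thetaPoint L j (l + 1)} : Finset _) := by
      rw [← h]; simp
    have hne := (thetaOf_adj_succ hL hk).ne
    rw [mem_insert, mem_singleton] at h1 h2
    have key : i = j ∧ k = l := by
      rcases h1 with h1 | h1 <;> rcases h2 with h2 | h2
      · exact absurd (h1.trans h2.symm) hne
      · rw [thetaPoint_eq_iff hk.le hl.le hi hj] at h1
        rw [thetaPoint_eq_iff hk hl hi hj] at h2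
        rcases h1 with h1 | h1 | h1
        · rcases h2 with h2 | h2 | h2
          · omega
          -- Here both edges join the two end vertices directly, so both paths have length one; `hs`
          -- excludes parallel edges.
          · exact ⟨hs i j (by omega) (by omega), by omega⟩
          · exact ⟨h2.1, by omega⟩
        · omega
        · exact h1
      · rw [thetaPoint_eq_iff hk.le hl hi hj] at h1
        rw [thetaPoint_eq_iff hk hl.le hi hj] at h2
        omega
      · exact absurd (h1.trans h2.symm) hne
    obtain ⟨rfl, rfl⟩ := key
    rfl
  rw [edgeCount, hE, card_image_of_injective _ hinj, card_univ, Fintype.card_sigma]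
  simp [Fin.sum_univ_three]

theorem isLConnected_thetaOf (hL : ∀ i, 1 ≤ L i) (hc : 4 ≤ L 0 + L 1 + L 2) :
    IsLConnected (thetaOf L) 2 := by
  refine isLConnected_two_of_forall_reachable (by have := card_thetaVertex hL; omega) fun x => ?_
  have hchain : ∀ (i : Fin 3) (k l : ℕ) (hkl : k ≤ l) (_ : l ≤ L i)
      (hne : ∀ m, k ≤ m → m ≤ l → thetaPoint L i m ∈ {y | y ≠ x}),
      ((thetaOf L).induce {y | y ≠ x}).Reachable ⟨thetaPoint L i k, hne k le_rfl hkl⟩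
        ⟨thetaPoint L i l, hne l hkl le_rfl⟩ := fun i k l hkl hl hne =>
    reachable_of_chain (thetaPoint L i) hkl
      (fun m _ h2 => thetaOf_adj_succ hL (by omega)) hne
  obtain ⟨j, l, hl, rfl⟩ := exists_eq_thetaPoint hL x
  have hj := hL j
  have hmem : ∀ i k, k ≤ L i → ¬ ((k = 0 ∧ l = 0) ∨ (k = L i ∧ l = L j) ∨ (i = j ∧ k = l)) →
      thetaPoint L i k ∈ {y | y ≠ thetaPoint L j l} := fun i k hk h => by
    rw [← thetaPoint_eq_iff hk hl (hL i) hj] at h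
    exact h
  rcases Nat.eq_zero_or_pos l with rfl | hl0
  -- With the start deleted, every point runs forward along its own path to the end vertex.
  · refine ⟨⟨thetaPoint L j (L j), hmem _ _ le_rfl (by omega)⟩, fun ⟨y, hy⟩ => ?_⟩
    obtain ⟨i, k, hk, rfl⟩ := exists_eq_thetaPoint hL y
    have hi := hL i
    have hk0 : k ≠ 0 := by
      rintro rfl
      exact hy ((thetaPoint_eq_iff hk hl hi hj).2 (by omega))
    have h := hchain i k (L i) hk le_rfl fun m h1 h2 => hmem _ _ h2 (by omega)
    have he : thetaPoint L j (L j) = thetaPoint L i (L i) := by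
      rw [thetaPoint_last hj, thetaPoint_last hi]
    simp only [he]
    exact h.symm
  · have hroot : thetaPoint L j 0 ∈ {y | y ≠ thetaPoint L j l} := hmem _ _ (Nat.zero_le _) (by omega)
    refine ⟨⟨thetaPoint L j 0, hroot⟩, fun ⟨y, hy⟩ => ?_⟩
    obtain ⟨i, k, hk, rfl⟩ := exists_eq_thetaPoint hL y
    have hi := hL i
    have hne := hy
    rw [Set.mem_ofPred_eq, Ne, thetaPoint_eq_iff hk hl hi hj] at hne
    have hzero : ∀ i, thetaPoint L j 0 = thetaPoint L i 0 := fun i => by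
      rw [thetaPoint_zero, thetaPoint_zero]
    -- A point beyond the deleted one on the same path is reached from the start by going round
    -- through another path; any other point is reached directly.
    by_cases hkl : i = j ∧ l < k
    · obtain ⟨rfl, hkl⟩ := hkl
      obtain ⟨i', hi'⟩ : ∃ i', i' ≠ i := exists_ne i
      have h1 := hchain i' 0 (L i') (Nat.zero_le _) le_rfl fun m _ h2 =>
        hmem _ _ h2 (by omega)
      have h2 := hchain i k (L i) hk le_rfl fun m h1 h2 => hmem _ _ h2 (by omega)
      have he : thetaPoint L i' (L i') = thetaPoint L i (L i) := by
        rw [thetaPoint_last (hL i'), thetaPoint_last hi]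
      simp only [hzero i']
      simp only [he] at h1
      exact h1.trans h2.symm
    · have h := hchain i 0 k (Nat.zero_le _) hk fun m h1 h2 => hmem _ _ (h2.trans hk) (by
        rintro (h | h | ⟨rfl, h⟩) <;> omega)
      simp only [hzero i]
      exact h

/-- A colouring of a theta graph by parity of the position, with a free colour at the end. -/
theorem thetaOf_exists_coloring (hL : ∀ i, 1 ≤ L i) {α : Type*} (c : ℕ → α) (d : α)
    (hc : ∀ k, c k ≠ c (k + 1)) (hd : ∀ i, c (L i - 1) ≠ d) :
    Nonempty ((thetaOf L).Coloring α) := by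
  let col : ThetaVertex L → α := fun x => match x with
    | Sum.inl false => c 0
    | Sum.inl true => d
    | Sum.inr p => c (p.2 + 1)
  have hcol : ∀ i k, k < L i → col (thetaPoint L i k) = c k := by
    intro i k hk
    rcases Nat.eq_zero_or_pos k with rfl | hk0
    · rw [thetaPoint_zero]
    · obtain ⟨k, rfl⟩ : ∃ k', k = k' + 1 := ⟨k - 1, by omega⟩
      rw [thetaPoint_succ hk]
  have hstep : ∀ i k, k < L i → col (thetaPoint L i k) ≠ col (thetaPoint L i (k + 1)) := by
    intro i k hk
    rw [hcol i k hk]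
    by_cases hk' : k + 1 < L i
    · rw [hcol i _ hk']
      exact hc k
    · have : k + 1 = L i := by omega
      rw [this, thetaPoint_last (hL i)]
      have h := hd i
      rwa [← this, Nat.add_sub_cancel] at h
  refine ⟨SimpleGraph.Coloring.mk col fun {x y} h => ?_⟩
  obtain ⟨i, k, hk, ⟨rfl, rfl⟩ | ⟨rfl, rfl⟩⟩ := (thetaOf_adj_iff hL).1 h
  · exact hstep i k hk
  · exact (hstep i k hk).symm

theorem thetaOf_colorable_three (hL : ∀ i, 1 ≤ L i) : (thetaOf L).Colorable 3 := by
  refine thetaOf_exists_coloring hL (fun k => if Even k then (0 : Fin 3) else 1) 2 ?_ ?_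
  · intro k
    by_cases h : Even k <;> simp [h, Nat.even_add_one]
  · intro i
    by_cases h : Even (L i - 1) <;> simp [h]

/-- In a 2-colouring colours alternate along each path, so whether the two ends agree is read off
from the parity of every path length. -/
theorem thetaOf_colorable_two_iff (hL : ∀ i, 1 ≤ L i) :
    (thetaOf L).Colorable 2 ↔ (∀ i, Odd (L i)) ∨ ∀ i, Even (L i) := by
  constructor
  · rintro ⟨c⟩
    have hpar : ∀ i k, k ≤ L i →
        (c (thetaPoint L i k) = c (Sum.inl false) ↔ Even k) := by
      intro i k
      induction k with
      | zero => simp [thetaPoint_zero]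
      | succ k ih =>
        intro hk
        have h1 := ih (by omega)
        have h2 := c.valid (thetaOf_adj_succ hL (show k < L i by omega))
        rw [Nat.even_add_one, ← h1]
        omega
    have hend : ∀ i, c (Sum.inl true) = c (Sum.inl false) ↔ Even (L i) := fun i => by
      rw [← hpar i _ le_rfl, thetaPoint_last (hL i)]
    by_cases h : c (Sum.inl true) = c (Sum.inl false)
    · exact Or.inr fun i => (hend i).1 h
    · exact Or.inl fun i => Nat.not_even_iff_odd.1 fun h' => h ((hend i).2 h')
  · intro h
    refine thetaOf_exists_coloring hL (fun k => if Even k then (0 : Fin 2) else 1)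
      (if Even (L 0) then 0 else 1) ?_ ?_
    · intro k
      by_cases h : Even k <;> simp [h, Nat.even_add_one]
    · intro i
      have hsub : Even (L i - 1) ↔ ¬ Even (L i) := by
        have := hL i
        have h' := Nat.even_add_one (n := L i - 1)
        rw [Nat.sub_add_cancel this] at h'
        tauto
      have h0 : Even (L 0) ↔ Even (L i) := by
        rcases h with h | h
        · simp [Nat.not_even_iff_odd.2 (h 0), Nat.not_even_iff_odd.2 (h i)]
        · simp [h 0, h i]
      by_cases hi : Even (L i) <;> simp [hsub, h0, hi]

end Theta

end IndepSets

namespace IndepSets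

/-! ### Recognising theta graphs, and the even case -/

section ThetaStructure

open Finset
open scoped Classical

universe u
variable {V : Type u} [Fintype V] {G : SimpleGraph V} {n : ℕ}

/-- Three internally disjoint chains starting at the neighbours of `v` and ending at `w`. -/
theorem nonempty_iso_thetaOf_of_chains (hG : G.Connected) (hmin : MinDegTwo G univ)
    (hcard : Fintype.card V = n) (hE : edgeCount G = n + 1) {L : Fin 3 → ℕ}
    (hL : ∀ i, 1 ≤ L i) {v w : V} (h : Fin 3 → ℕ → V)
    (hlast : ∀ i, h i (L i - 1) = w) (hfirst : ∀ i, G.Adj v (h i 0))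
    (hv : ∀ i k, h i k ≠ v)
    (hadj : ∀ i k, k + 1 < L i → G.Adj (h i k) (h i (k + 1)))
    (hinj : ∀ i j k l, k < L i → l < L j → h i k = h j l →
      (i = j ∧ k = l) ∨ (k + 1 = L i ∧ l + 1 = L j))
    (hdist : ∀ i j, h i 0 = h j 0 → i = j) :
    Nonempty (G ≃g thetaOf L) := by
  let F : ThetaVertex L → V := fun x => match x with
    | Sum.inl false => v
    | Sum.inl true => w
    | Sum.inr p => h p.1 p.2
  have hF0 : ∀ i, F (thetaPoint L i 0) = v := fun i => by rw [thetaPoint_zero]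
  -- Chain indices are shifted by one: position `0` on every path is `v`, and the chains begin at
  -- its neighbours.
  have hF : ∀ i k, k < L i → F (thetaPoint L i (k + 1)) = h i k := by
    intro i k hk
    by_cases hk' : k + 1 < L i
    · rw [thetaPoint_succ hk']
    · have : k + 1 = L i := by omega
      rw [this, thetaPoint_last (hL i)]
      have h1 := hlast i
      rw [← this, Nat.add_sub_cancel] at h1
      exact h1.symm
  have hstep : ∀ i k, k < L i → G.Adj (F (thetaPoint L i k)) (F (thetaPoint L i (k + 1))) := by
    intro i k hk
    rw [hF i k hk]
    rcases Nat.eq_zero_or_pos k with rfl | hk0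
    · rw [hF0]
      exact hfirst i
    · obtain ⟨k, rfl⟩ : ∃ k', k = k' + 1 := ⟨k - 1, by omega⟩
      rw [hF i k (by omega)]
      exact hadj i k hk
  let f : thetaOf L →g G := ⟨F, fun {x y} hxy => by
    obtain ⟨i, k, hk, ⟨rfl, rfl⟩ | ⟨rfl, rfl⟩⟩ := (thetaOf_adj_iff hL).1 hxy
    · exact hstep i k hk
    · exact (hstep i k hk).symm⟩
  have hf : Function.Injective f := by
    intro x y hxy
    change F x = F y at hxy
    obtain ⟨i, k, hk, rfl⟩ := exists_eq_thetaPoint hL x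
    obtain ⟨j, l, hl, rfl⟩ := exists_eq_thetaPoint hL y
    rw [thetaPoint_eq_iff hk hl (hL i) (hL j)]
    rcases Nat.eq_zero_or_pos k with rfl | hk0 <;> rcases Nat.eq_zero_or_pos l with rfl | hl0
    · exact Or.inl ⟨rfl, rfl⟩
    · obtain ⟨l, rfl⟩ : ∃ k', l = k' + 1 := ⟨l - 1, by omega⟩
      rw [hF0, hF j l hl] at hxy
      exact absurd hxy.symm (hv j l)
    · obtain ⟨k, rfl⟩ : ∃ k', k = k' + 1 := ⟨k - 1, by omega⟩
      rw [hF0, hF i k hk] at hxy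
      exact absurd hxy (hv i k)
    · obtain ⟨l, rfl⟩ : ∃ k', l = k' + 1 := ⟨l - 1, by omega⟩
      obtain ⟨k, rfl⟩ : ∃ k', k = k' + 1 := ⟨k - 1, by omega⟩
      rw [hF j l hl, hF i k hk] at hxy
      rcases hinj i j k l hk hl hxy with h1 | h1
      · exact Or.inr (Or.inr ⟨h1.1, by omega⟩)
      · exact Or.inr (Or.inl h1)
  have hs : ∀ i j, L i = 1 → L j = 1 → i = j := by
    intro i j hi hj
    have h1 := hlast i
    have h2 := hlast j
    rw [hi] at h1
    rw [hj] at h2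
    exact hdist i j (h1.trans h2.symm)
  have hne : Nonempty (ThetaVertex L) := ⟨Sum.inl false⟩
  refine nonempty_iso_of_injective_hom hG hmin f hf ?_
  have := card_thetaVertex hL
  rw [edgeCount_thetaOf hL hs]
  omega

/-- Three vertices of a connected graph are the ends of three paths with a common end which
are otherwise disjoint. -/
theorem exists_tripod {W : Type u} {H : SimpleGraph W} (hH : H.Connected) (x y z : W) :
    ∃ (w : W) (L : Fin 3 → ℕ) (h : Fin 3 → ℕ → W), (∀ i, 1 ≤ L i) ∧
      h 0 0 = x ∧ h 1 0 = y ∧ h 2 0 = z ∧ (∀ i, h i (L i - 1) = w) ∧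
      (∀ i k, k + 1 < L i → H.Adj (h i k) (h i (k + 1))) ∧
      (∀ i j k l, k < L i → l < L j → h i k = h j l →
        (i = j ∧ k = l) ∨ (k + 1 = L i ∧ l + 1 = L j)) := by
  obtain ⟨p, hp⟩ := (hH.preconnected x y).exists_isPath
  -- A shortest walk from `z` to the path `p` from `x` to `y` is the third leg; by minimality it
  -- meets `p` only at its endpoint, which is the centre `w`. A leg may be trivial, with `L i = 1`.
  have hex : ∃ N, ∃ m, m ≤ p.length ∧ ∃ q : H.Walk z (p.getVert m), q.length = N := by
    obtain ⟨q⟩ := hH.preconnected z (p.getVert 0)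
    exact ⟨q.length, 0, Nat.zero_le _, q, rfl⟩
  obtain ⟨m, hm, q0, hq0⟩ := Nat.find_spec hex
  have hmin : ∀ m', m' ≤ p.length → ∀ q' : H.Walk z (p.getVert m'),
      Nat.find hex ≤ q'.length := fun m' hm' q' => Nat.find_min' hex ⟨m', hm', q', rfl⟩
  set q := q0.bypass with hqdef
  have hq : q.IsPath := q0.bypass_isPath
  have hqlen : q.length ≤ Nat.find hex := by rw [← hq0]; exact q0.length_bypass_le_length
  have hoff : ∀ k m', k ≤ q.length → m' ≤ p.length → q.getVert k = p.getVert m' →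
      k = q.length := by
    intro k m' hk hm' heq
    have h1 := hmin m' hm' ((q.take k).copy rfl heq)
    rw [SimpleGraph.Walk.length_copy, SimpleGraph.Walk.take_length] at h1
    omega
  have hpinj : ∀ k l, k ≤ p.length → l ≤ p.length → p.getVert k = p.getVert l → k = l :=
    fun k l hk hl h => hp.getVert_injOn hk hl h
  have hqinj : ∀ k l, k ≤ q.length → l ≤ q.length → q.getVert k = q.getVert l → k = l :=
    fun k l hk hl h => hq.getVert_injOn hk hl h
  have hqend : q.getVert q.length = p.getVert m := q.getVert_length
  refine ⟨p.getVert m, ![m + 1, p.length - m + 1, q.length + 1],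
    ![fun k => p.getVert k, fun k => p.getVert (p.length - k), fun k => q.getVert k],
    ?_, ?_, ?_, ?_, ?_, ?_, ?_⟩
  · intro i; fin_cases i <;> simp
  · simp
  · simp
  · simp
  · intro i
    fin_cases i
    · simp
    · simp [Nat.sub_sub_self hm]
    · simp
  · intro i k hk
    fin_cases i
    · simp only [Fin.zero_eta, Matrix.cons_val_zero] at hk ⊢
      exact p.adj_getVert_succ (by omega)
    · simp only [Fin.mk_one, Matrix.cons_val_one, Matrix.cons_val_zero] at hk ⊢
      have := p.adj_getVert_succ (i := p.length - (k + 1)) (by omega)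
      rw [show p.length - (k + 1) + 1 = p.length - k by omega] at this
      exact this.symm
    · simp only [Fin.reduceFinMk, Matrix.cons_val] at hk ⊢
      exact q.adj_getVert_succ (by omega)
  · intro i j k l hk hl h
    fin_cases i <;> fin_cases j <;>
      simp only [Fin.zero_eta, Fin.mk_one, Fin.reduceFinMk, Matrix.cons_val,
        Matrix.cons_val_zero, Matrix.cons_val_one] at hk hl h ⊢
    · exact Or.inl ⟨trivial, hpinj _ _ (by omega) (by omega) h⟩
    · have := hpinj _ _ (by omega) (by omega) h
      omega
    · have h1 := hoff _ _ (by omega) (by omega) h.symm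
      subst h1
      have := hpinj _ _ (by omega) (by omega) (h.trans hqend)
      omega
    · have := hpinj _ _ (by omega) (by omega) h
      omega
    · have := hpinj _ _ (by omega) (by omega) h
      exact Or.inl ⟨trivial, by omega⟩
    · have h1 := hoff _ _ (by omega) (by omega) h.symm
      subst h1
      have := hpinj _ _ (by omega) (by omega) (h.trans hqend)
      omega
    · have h1 := hoff _ _ (by omega) (by omega) h
      subst h1
      have := hpinj _ _ (by omega) (by omega) (hqend.symm.trans h)
      omega
    · have h1 := hoff _ _ (by omega) (by omega) h
      subst h1
      have := hpinj _ _ (by omega) (by omega) (hqend.symm.trans h)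
      omega
    · exact Or.inl ⟨trivial, hqinj _ _ (by omega) (by omega) h⟩

/-- A `2`-connected graph with one more edge than vertices is a theta graph. -/
theorem exists_iso_thetaOf (hG : IsLConnected G 2) (hE : edgeCount G = Fintype.card V + 1) :
    ∃ L : Fin 3 → ℕ, (∀ i, 1 ≤ L i) ∧ (∀ i j, L i = 1 → L j = 1 → i = j) ∧
      Nonempty (G ≃g thetaOf L) := by
  -- The degree sum is `2n + 2`, so some vertex has degree at least three. It and the centre of a
  -- tripod joining three of its neighbours, taken in the connected graph without it, are the two
  -- ends of the theta graph.
  have hmin := hG.minDegTwo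
  obtain ⟨v, hv⟩ : ∃ v, 3 ≤ #(nbrs G univ v) := by
    by_contra hcon
    push Not at hcon
    have h1 := sum_card_nbrs G univ
    have h2 : ∑ v, #(nbrs G univ v) ≤ ∑ _v : V, 2 := sum_le_sum fun v _ => by
      have := hcon v
      omega
    rw [h1, sum_const, card_univ, smul_eq_mul] at h2
    change 2 * edgeCount G ≤ _ at h2
    omega
  obtain ⟨x, hx, y, hy, z, hz, hxy, hxz, hyz⟩ := two_lt_card.1 hv
  rw [mem_nbrs] at hx hy hz
  obtain ⟨w, L, h, hL, h0, h1, h2, hlast, hadj, hinj⟩ :=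
    exists_tripod (hG.connected_induce_ne v) ⟨x, hx.2.ne'⟩ ⟨y, hy.2.ne'⟩ ⟨z, hz.2.ne'⟩
  have hdist : ∀ i j, (h i 0).1 = (h j 0).1 → i = j := by
    intro i j hij
    fin_cases i <;> fin_cases j <;> simp [h0, h1, h2] at hij ⊢ <;> first
      | exact hxy hij | exact hxz hij | exact hyz hij
      | exact hxy hij.symm | exact hxz hij.symm | exact hyz hij.symm
  refine ⟨L, hL, ?_, nonempty_iso_thetaOf_of_chains hG.connected hmin rfl hE hL (v := v)
    (w := w.1) (fun i k => (h i k).1) (fun i => by rw [hlast]) ?_ (fun i k => (h i k).2)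
    (fun i k hk => hadj i k hk) (fun i j k l hk hl heq => hinj i j k l hk hl (Subtype.ext heq))
    hdist⟩
  · intro i j hi hj
    have e1 := hlast i
    have e2 := hlast j
    rw [hi] at e1
    rw [hj] at e2
    exact hdist i j (congrArg Subtype.val (e1.trans e2.symm))
  · intro i
    fin_cases i
    · simpa [h0] using hx.2
    · simpa [h1] using hy.2
    · simpa [h2] using hz.2

theorem thetaGraph_eq (a b c : ℕ) : thetaGraph a b c = thetaOf ![a, b, c] := rfl

namespace IsEvenThetaTriple

variable {a b c : ℕ}

theorem one_le (h : IsEvenThetaTriple n a b c) (i : Fin 3) : 1 ≤ ![a, b, c] i := by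
  fin_cases i
  · exact h.pos_a
  · exact h.pos_b
  · exact h.pos_c

theorem eq_of_eq_one (h : IsEvenThetaTriple n a b c) (i j : Fin 3) (hi : ![a, b, c] i = 1)
    (hj : ![a, b, c] j = 1) : i = j := by
  have h1 := h.simple_ab
  have h2 := h.simple_ac
  have h3 := h.simple_bc
  fin_cases i <;> fin_cases j <;> simp at hi hj ⊢ <;> tauto

theorem edgeCount_eq (h : IsEvenThetaTriple n a b c) : edgeCount (thetaGraph a b c) = n + 1 := by
  rw [thetaGraph_eq, edgeCount_thetaOf h.one_le h.eq_of_eq_one]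
  exact h.vertices

theorem isThreeChromTwoConn (h : IsEvenThetaTriple n a b c) (hn : 4 ≤ n) (heven : Even n) :
    IsThreeChromTwoConn (thetaGraph a b c) n := by
  have hv := h.vertices
  refine ⟨?_, ?_, ?_⟩
  · have : _ = a + b + c := card_thetaVertex h.one_le
    omega
  · rw [chromaticNumber_eq_three_iff, thetaGraph_eq]
    refine ⟨thetaOf_colorable_three h.one_le, ?_⟩
    rw [thetaOf_colorable_two_iff h.one_le]
    have he := h.even
    rintro (h' | h')
    · have h0 : Odd a := h' 0
      have h1 : Odd b := h' 1
      have h2 : Odd c := h' 2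
      rw [← Nat.not_even_iff_odd] at h0 h1 h2
      tauto
    · have h0 : Even a := h' 0
      have h1 : Even b := h' 1
      have h2 : Even c := h' 2
      -- All lengths even is impossible by parity: they sum to `n + 1`, which is odd.
      have := (h0.add h1).add h2
      rw [hv] at this
      exact (Nat.even_add_one.1 this) heven
  · rw [thetaGraph_eq]
    refine isLConnected_thetaOf h.one_le ?_
    have : a + b + c = n + 1 := hv
    change 4 ≤ a + b + c
    omega

end IsEvenThetaTriple

/-- With only `n` edges the graph would be an even cycle, which is 2-colourable. -/
theorem succ_le_edgeCount_of_even (hG : IsThreeChromTwoConn G n) (heven : Even n) :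
    n + 1 ≤ edgeCount G := by
  have h := hG.connected.minDegTwo.card_le_edgeCount
  rw [hG.card_eq] at h
  have hn := hG.connected.1
  rw [hG.card_eq] at hn
  by_contra hlt
  obtain ⟨e⟩ := nonempty_iso_cycleGraph hG.connected.connected hG.connected.minDegTwo hG.card_eq
    (by omega)
  have hc := SimpleGraph.chromaticNumber_cycleGraph_of_even n (by omega) heven
  have h2 : (SimpleGraph.cycleGraph n).Colorable 2 :=
    SimpleGraph.chromaticNumber_le_iff_colorable.1 hc.le
  exact (chromaticNumber_eq_three_iff.1 hG.chromatic).2 (h2.of_hom e.toHom)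

theorem exists_isEvenThetaTriple_iso (hG : IsThreeChromTwoConn G n) (hE : edgeCount G = n + 1) :
    ∃ a b c : ℕ, IsEvenThetaTriple n a b c ∧ Nonempty (G ≃g thetaGraph a b c) := by
  obtain ⟨L, hL, hs, ⟨e⟩⟩ := exists_iso_thetaOf hG.connected (by rw [hE, hG.card_eq])
  have hLeq : ![L 0, L 1, L 2] = L := by
    ext i
    fin_cases i <;> rfl
  refine ⟨L 0, L 1, L 2, ⟨hL 0, hL 1, hL 2, ?_, ?_, ?_, ?_, ?_⟩, ?_⟩
  · rintro ⟨h1, h2⟩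
    exact absurd (hs 0 1 h1 h2) (by decide)
  · rintro ⟨h1, h2⟩
    exact absurd (hs 0 2 h1 h2) (by decide)
  · rintro ⟨h1, h2⟩
    exact absurd (hs 1 2 h1 h2) (by decide)
  · rw [← hE, edgeCount_congr e, edgeCount_thetaOf hL hs]
  · by_contra hcon
    push Not at hcon
    refine (chromaticNumber_eq_three_iff.1 hG.chromatic).2
      (((thetaOf_colorable_two_iff hL).2 (Or.inl fun i => ?_)).of_hom e.toHom)
    rw [← Nat.not_even_iff_odd]
    fin_cases i
    · exact hcon.1
    · exact hcon.2.1
    · exact hcon.2.2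
  · rw [thetaGraph_eq, hLeq]
    exact ⟨e⟩

theorem exists_isEvenThetaTriple (hn : 4 ≤ n) : ∃ a b c : ℕ, IsEvenThetaTriple n a b c :=
  -- The cycle on `n` vertices with a chord cutting off a triangle: length `2` is even, and `n - 2 ≥
  -- 2` leaves just one length equal to `1`.
  ⟨1, 2, n - 2, by omega, by omega, by omega, by omega, by omega, by omega, by omega,
    Or.inr (Or.inl (by decide))⟩

theorem numIndep_two_le_thetaGraph {a b c : ℕ} (h : IsEvenThetaTriple n a b c) (hn : 4 ≤ n)
    (heven : Even n) (hG : IsThreeChromTwoConn G n) :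
    numIndep G 2 ≤ numIndep (thetaGraph a b c) 2 ∧
      (numIndep G 2 = numIndep (thetaGraph a b c) 2 ↔
        ∃ a' b' c' : ℕ, IsEvenThetaTriple n a' b' c' ∧ Nonempty (G ≃g thetaGraph a' b' c')) := by
  have h1 := numIndep_two_add_edgeCount G
  have h2 := numIndep_two_add_edgeCount (thetaGraph a b c)
  have h3 := succ_le_edgeCount_of_even hG heven
  have h4 := hG.connected.minDegTwo.card_le_edgeCount
  rw [(h.isThreeChromTwoConn hn heven).card_eq, h.edgeCount_eq] at h2
  rw [hG.card_eq] at h1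
  have h5 : n + 1 ≤ n.choose 2 := by omega
  refine ⟨by omega, fun heq => exists_isEvenThetaTriple_iso hG (by omega), ?_⟩
  rintro ⟨a', b', c', h', ⟨e⟩⟩
  have := edgeCount_congr e
  rw [h'.edgeCount_eq] at this
  omega

end ThetaStructure

end IndepSets

theorem mainTheorem3 (n : ℕ) (hn : 4 ≤ n) :
    (Odd n →
      IndepSets.IsThreeChromTwoConn (SimpleGraph.cycleGraph n) n ∧
      ∀ (V : Type*) [Fintype V] (G : SimpleGraph V), IndepSets.IsThreeChromTwoConn G n →
        IndepSets.numIndep G 2 ≤ IndepSets.numIndep (SimpleGraph.cycleGraph n) 2 ∧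
        (IndepSets.numIndep G 2 = IndepSets.numIndep (SimpleGraph.cycleGraph n) 2 ↔
          Nonempty (G ≃g SimpleGraph.cycleGraph n))) ∧
    (Even n →
      (∃ a b c : ℕ, IndepSets.IsEvenThetaTriple n a b c) ∧
      ∀ a b c : ℕ, IndepSets.IsEvenThetaTriple n a b c →
        IndepSets.IsThreeChromTwoConn (IndepSets.thetaGraph a b c) n ∧
        ∀ (V : Type*) [Fintype V] (G : SimpleGraph V), IndepSets.IsThreeChromTwoConn G n →
          IndepSets.numIndep G 2 ≤ IndepSets.numIndep (IndepSets.thetaGraph a b c) 2 ∧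
          (IndepSets.numIndep G 2 = IndepSets.numIndep (IndepSets.thetaGraph a b c) 2 ↔
            ∃ a' b' c' : ℕ, IndepSets.IsEvenThetaTriple n a' b' c' ∧
              Nonempty (G ≃g IndepSets.thetaGraph a' b' c'))) ∧
    (IndepSets.IsThreeChromTwoConn (IndepSets.K2JoinEmpty (n - 2)) n ∧
      ∀ (V : Type*) [Fintype V] (G : SimpleGraph V), IndepSets.IsThreeChromTwoConn G n →
        ∀ t : ℕ, 3 ≤ t → t ≤ n - 2 →
          IndepSets.numIndep G t ≤ IndepSets.numIndep (IndepSets.K2JoinEmpty (n - 2)) t ∧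
          (5 ≤ n →
            (IndepSets.numIndep G t = IndepSets.numIndep (IndepSets.K2JoinEmpty (n - 2)) t ↔
              Nonempty (G ≃g IndepSets.K2JoinEmpty (n - 2))))) := by
  refine ⟨fun hodd => ⟨IndepSets.isThreeChromTwoConn_cycleGraph (by omega) hodd, ?_⟩,
    fun heven => ⟨IndepSets.exists_isEvenThetaTriple hn, fun a b c h => ⟨?_, ?_⟩⟩, ?_, ?_⟩
  · exact fun V _ G hG => IndepSets.numIndep_two_le_cycleGraph (by omega) hG
  · exact h.isThreeChromTwoConn hn heven
  · exact fun V _ G hG => IndepSets.numIndep_two_le_thetaGraph h hn heven hG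
  · have h := IndepSets.K2JoinEmpty_isThreeChromTwoConn (m := n - 2) (by omega)
    rwa [Nat.sub_add_cancel (by omega)] at h
  · intro V _ G hG t ht htn
    have h := IndepSets.numIndep_le_K2JoinEmpty hG hn ht htn
    exact ⟨h.1, fun _ => h.2⟩
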